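/- Let $\mathbf{Ope}_\Sigma$ be the category of small symmetric operads (symmetric multicategories: a set of objects, sets $\mathcal P(p_1,\dots,p_n;p_0)$ of morphisms for all $n\ge 0$, identities, associative and unital composition, and compatible actions of the symmetric groups) and functors between them (maps preserving identities, composition and the symmetric group actions). For symmetric operads $\mathcal P,\mathcal Q$ the Boardman–Vogt tensor product $\mathcal P\otimes\mathcal Q$ is the symmetric operad with object set $\mathrm{ob}(\mathcal P)\times\mathrm{ob}(\mathcal Q)$ generated by morphisms $\psi\otimes q:(p_1,q),\dots,(p_n,q)\to(p,q)$ for $\psi\in\mathcal P(p_1,\dots,p_n;p)$, $q\in\mathrm{ob}(\mathcal Q)$, and $p\otimes\varphi:(p,q_1),\dots,(p,q_m)\to(p,q)$ for $p\in\mathrm{ob}(\mathcal P)$, $\varphi\in\mathcal Q(q_1,\dots,q_m;q)$, subject to the relations that $\psi\mapsto\psi\otimes q$ and $\varphi\mapsto p\otimes\varphi$ preserve identities, composition and the symmetric group actions, and that $$(\psi\otimes q)\circ(p_1\otimes\varphi,\dots,p_n\otimes\varphi)=\sigma_{m,n}^*\big((p\otimes\varphi)\circ(\psi\otimes q_1,\dots,\psi\otimes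 q_m)\big),$$ where $\sigma_{m,n}$ is the permutation that matches the two domains. For functors $F,G$, the functor $F\otimes G$ is $F\times G$ on objects and sends $\psi\otimes q$ to $F\psi\otimes Gq$ and $p\otimes\varphi$ to $Fp\otimes G\varphi$. Theorem. (1) $\mathbf{Ope}_\Sigma$ is a monoidal category whose tensor product (of objects and of functors) is the Boardman–Vogt tensor product, whose unit is the operad $\star$ with one object and only its identity morphism, and whose associativity and unit isomorphisms are given on objects by $((p,q),s)\mapsto(p,(q,s))$, $(*,p)\mapsto p$ and $(p,*)\mapsto p$. (2) $\mathbf{Ope}_\Sigma$ is small complete and small cocomplete, and it has a Quillen model structure in which - the weak equivalences are the functors $F:\mathcal P\to\mathcal Q$ that are essentially surjective (on the underlying categories of unary morphisms) and fully faithful (each map $\mathcal P(p_1,\dots,p_n;p_0)\to\mathcal Q(Fp_1,\dots,Fp_n;Fp_0)$ is a bijection); - the cofibrations are the functors that are injective on objects; - the fibrations are the functors $F:\mathcal P\to\mathcal Q$ such that for each object $p$ of $\mathcal P$ and each isomorphism $\psi:Fp\to q$ in $\mathcal Q$ there is an isomorphism $\phi:p\to p'$ in $\mathcal P$ with $F\phi=\psi$.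 (3) With the structures of (1) and (2), $\mathbf{Ope}_\Sigma$ is a monoidal model category in the following sense: every object is cofibrant, and for all cofibrations $F:\mathcal P\to\mathcal Q$ and $G:\mathcal P'\to\mathcal Q'$ the pushout-product (corner map) $$F\wedge G:(\mathcal Q\otimes\mathcal P')\sqcup_{\mathcal P\otimes\mathcal P'}(\mathcal P\otimes\mathcal Q')\to\mathcal Q\otimes\mathcal Q'$$ is a cofibration, and it is a trivial cofibration (a cofibration and a weak equivalence) if $F$ or $G$ is a trivial cofibration. -/

import Mathlib

open CategoryTheory Limits HomotopicalAlgebra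

universe u v

/-! ## Concatenation of finite lists -/

namespace FinBlock

variable {X : Type u}

/-- The concatenation `d 0 ++ d 1 ++ ... ++ d (n-1)` of finite lists. -/
abbrev concat {n : ℕ} {k : Fin n → ℕ} (d : ∀ i, Fin (k i) → X) : Fin (∑ i, k i) → X :=
  fun x => d (finSigmaFinEquiv.symm x).1 (finSigmaFinEquiv.symm x).2

/-- A bijection between the double indices, as a bijection between the positions in the
concatenated lists. -/
def blockEquiv {n m : ℕ} {k : Fin n → ℕ} {l : Fin m → ℕ}
    (E : (Σ i, Fin (k i)) ≃ Σ j, Fin (l j)) : Fin (∑ i, k i) ≃ Fin (∑ j, l j) :=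
  finSigmaFinEquiv.symm.trans (E.trans finSigmaFinEquiv)

theorem concat_blockEquiv {n m : ℕ} {k : Fin n → ℕ} {l : Fin m → ℕ}
    (E : (Σ i, Fin (k i)) ≃ Σ j, Fin (l j)) (d : ∀ i, Fin (k i) → X) (d' : ∀ j, Fin (l j) → X)
    (h : ∀ i j, d i j = d' (E ⟨i, j⟩).1 (E ⟨i, j⟩).2) (x : Fin (∑ i, k i)) :
    concat d x = concat d' (blockEquiv E x) :=
  (h _ _).trans (congrArg (fun z : Σ j, Fin (l j) => d' z.1 z.2)
    (Equiv.symm_apply_apply finSigmaFinEquiv _).symm)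

/-- The block permutation induced by a permutation of the blocks. -/
def outerEquiv {n m : ℕ} (σ : Fin n ≃ Fin m) (k : Fin m → ℕ) :
    Fin (∑ i, k (σ i)) ≃ Fin (∑ j, k j) :=
  blockEquiv (Equiv.sigmaCongrLeft (β := fun j => Fin (k j)) σ)

/-- The permutation which permutes each block separately. -/
def innerEquiv {n : ℕ} {k l : Fin n → ℕ} (τ : ∀ i, Fin (k i) ≃ Fin (l i)) :
    Fin (∑ i, k i) ≃ Fin (∑ i, l i) :=
  blockEquiv (Equiv.sigmaCongrRight τ)

/-- The identification of the positions in the two ways to concatenate twice. -/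
def assocEquiv {n : ℕ} (k : Fin n → ℕ) (l : ∀ i, Fin (k i) → ℕ) :
    Fin (∑ x, concat l x) ≃ Fin (∑ i, ∑ j, l i j) :=
  blockEquiv <|
    (Equiv.sigmaCongrLeft (β := fun y : Σ i, Fin (k i) => Fin (l y.1 y.2))
      finSigmaFinEquiv.symm).trans <|
    (Equiv.sigmaAssoc (fun i (j : Fin (k i)) => Fin (l i j))).trans <|
    Equiv.sigmaCongrRight (fun _ => finSigmaFinEquiv)

/-- The positions in the concatenation of a single list. -/
def oneBlockEquiv (n : ℕ) : Fin (∑ _i : Fin 1, n) ≃ Fin n :=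
  finSigmaFinEquiv.symm.trans ((Equiv.sigmaEquivProd _ _).trans (Equiv.uniqueProd _ _))

/-- The positions in the concatenation of `n` lists of length one. -/
def onesEquiv (n : ℕ) : Fin (∑ _i : Fin n, 1) ≃ Fin n :=
  finSigmaFinEquiv.symm.trans (Equiv.sigmaUnique (Fin n) (fun _ => Fin 1))

/-- Interchange of rows and columns: it sends the `j`-th position of the `i`-th block to the
`i`-th position of the `j`-th block. -/
def swapEquiv (n m : ℕ) : Fin (∑ _i : Fin n, m) ≃ Fin (∑ _j : Fin m, n) :=
  blockEquiv ((Equiv.sigmaEquivProd _ _).trans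
    ((Equiv.prodComm _ _).trans (Equiv.sigmaEquivProd _ _).symm))

theorem concat_assoc {n : ℕ} {k : Fin n → ℕ} {l : ∀ i, Fin (k i) → ℕ}
    (e : ∀ i j, Fin (l i j) → X) (x : Fin (∑ x, concat l x)) :
    concat (fun x => e (finSigmaFinEquiv.symm x).1 (finSigmaFinEquiv.symm x).2) x =
      concat (fun i => concat (e i)) (assocEquiv k l x) := by
  refine concat_blockEquiv _ _ _ (fun y z => ?_) x
  exact congrArg (fun w : Σ j, Fin (l (finSigmaFinEquiv.symm y).1 j) =>
    e (finSigmaFinEquiv.symm y).1 w.1 w.2)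
    (Equiv.symm_apply_apply finSigmaFinEquiv ⟨(finSigmaFinEquiv.symm y).2, z⟩).symm

end FinBlock

open FinBlock

/-! ## Symmetric operads -/

/-- A (small, coloured) symmetric operad, also known as a symmetric multicategory.
The set of morphisms `c 0, ..., c (n-1) → p` is `Hom c p`.  For a permutation `σ` the map `σ^*` from
`Hom c p` to `Hom (c ∘ σ) p` is `act σ`; since the lengths of the lists are natural
numbers, which may agree without being syntactically the same, the permutation is a bijection
`Fin n ≃ Fin m` (so that `n = m`), and the new domain is any list `d` equal to `c ∘ σ`. -/
structure SymmOperad where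
  /-- the objects -/
  Ob : Type u
  /-- the morphisms -/
  Hom : ∀ {n : ℕ}, (Fin n → Ob) → Ob → Type u
  /-- the identities -/
  id : ∀ p : Ob, Hom (fun _ : Fin 1 => p) p
  /-- the composition `ψ ∘ (χ 0, ..., χ (n-1))` -/
  comp : ∀ {n : ℕ} {k : Fin n → ℕ} {c : Fin n → Ob} {d : ∀ i, Fin (k i) → Ob} {p : Ob},
    Hom c p → (∀ i, Hom (d i) (c i)) → Hom (concat d) p
  /-- the action of the permutations -/
  act : ∀ {n m : ℕ} {c : Fin m → Ob} {d : Fin n → Ob} {p : Ob} (σ : Fin n ≃ Fin m),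
    (∀ i, d i = c (σ i)) → Hom c p → Hom d p
  act_refl : ∀ {n : ℕ} {c : Fin n → Ob} {p : Ob} (ψ : Hom c p),
    act (Equiv.refl _) (fun _ => rfl) ψ = ψ
  act_act : ∀ {n m r : ℕ} {c : Fin r → Ob} {d : Fin m → Ob} {e : Fin n → Ob} {p : Ob}
    (σ : Fin m ≃ Fin r) (τ : Fin n ≃ Fin m) (hσ : ∀ i, d i = c (σ i)) (hτ : ∀ i, e i = d (τ i))
    (ψ : Hom c p),
    act τ hτ (act σ hσ ψ) = act (τ.trans σ) (fun i => (hτ i).trans (hσ (τ i))) ψ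
  id_comp : ∀ {n : ℕ} {c : Fin n → Ob} {p : Ob} (ψ : Hom c p),
    comp (id p) (fun _ => ψ) = act (oneBlockEquiv n) (fun _ => rfl) ψ
  comp_id : ∀ {n : ℕ} {c : Fin n → Ob} {p : Ob} (ψ : Hom c p),
    comp ψ (fun i => id (c i)) = act (onesEquiv n) (fun _ => rfl) ψ
  assoc : ∀ {n : ℕ} {k : Fin n → ℕ} {l : ∀ i, Fin (k i) → ℕ}
    {c : Fin n → Ob} {d : ∀ i, Fin (k i) → Ob} {e : ∀ i j, Fin (l i j) → Ob} {p : Ob}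
    (ψ : Hom c p) (χ : ∀ i, Hom (d i) (c i)) (ω : ∀ i j, Hom (e i j) (d i j)),
    comp (comp ψ χ) (fun x => ω (finSigmaFinEquiv.symm x).1 (finSigmaFinEquiv.symm x).2) =
      act (assocEquiv k l) (concat_assoc e) (comp ψ (fun i => comp (χ i) (ω i)))
  act_comp : ∀ {n m : ℕ} {k : Fin m → ℕ} {c : Fin m → Ob} {d : ∀ j, Fin (k j) → Ob} {p : Ob}
    (σ : Fin n ≃ Fin m) (ψ : Hom c p) (χ : ∀ j, Hom (d j) (c j)),
    comp (act (d := fun i => c (σ i)) σ (fun _ => rfl) ψ) (fun i => χ (σ i)) =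
      act (outerEquiv σ k) (concat_blockEquiv _ _ _ (fun _ _ => rfl)) (comp ψ χ)
  comp_act : ∀ {n : ℕ} {k l : Fin n → ℕ} {c : Fin n → Ob} {d : ∀ i, Fin (l i) → Ob} {p : Ob}
    (τ : ∀ i, Fin (k i) ≃ Fin (l i)) (ψ : Hom c p) (χ : ∀ i, Hom (d i) (c i)),
    comp ψ (fun i => act (d := fun j => d i (τ i j)) (τ i) (fun _ => rfl) (χ i)) =
      act (innerEquiv τ) (concat_blockEquiv _ _ _ (fun _ _ => rfl)) (comp ψ χ)

namespace SymmOperad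

/-- A functor (map) of symmetric operads. -/
@[ext]
structure Functor (P Q : SymmOperad.{u}) where
  /-- the function on objects -/
  obj : P.Ob → Q.Ob
  /-- the functions on morphisms -/
  map : ∀ {n : ℕ} {c : Fin n → P.Ob} {p : P.Ob}, P.Hom c p → Q.Hom (fun i => obj (c i)) (obj p)
  map_id : ∀ p, map (P.id p) = Q.id (obj p)
  map_comp : ∀ {n : ℕ} {k : Fin n → ℕ} {c : Fin n → P.Ob} {d : ∀ i, Fin (k i) → P.Ob} {p : P.Ob}
    (ψ : P.Hom c p) (χ : ∀ i, P.Hom (d i) (c i)),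
    map (P.comp ψ χ) = Q.comp (map ψ) (fun i => map (χ i))
  map_act : ∀ {n m : ℕ} {c : Fin m → P.Ob} {d : Fin n → P.Ob} {p : P.Ob} (σ : Fin n ≃ Fin m)
    (h : ∀ i, d i = c (σ i)) (ψ : P.Hom c p),
    map (P.act σ h ψ) = Q.act σ (fun i => congrArg obj (h i)) (map ψ)

/-- The category of small symmetric operads. -/
instance : Category SymmOperad.{u} where
  Hom := Functor
  id P :=
    { obj := fun p => p
      map := fun ψ => ψ
      map_id := fun _ => rfl
      map_comp := fun _ _ => rfl
      map_act := fun _ _ _ => rfl }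
  comp F G :=
    { obj := fun p => G.obj (F.obj p)
      map := fun ψ => G.map (F.map ψ)
      map_id := fun p => by rw [F.map_id, G.map_id]
      map_comp := fun ψ χ => (congrArg G.map (F.map_comp ψ χ)).trans
        (G.map_comp (F.map ψ) (fun i => F.map (χ i)))
      map_act := fun σ h ψ => (congrArg G.map (F.map_act σ h ψ)).trans (G.map_act σ _ (F.map ψ)) }

/-! ## The underlying category -/

/-- The category underlying a symmetric operad: the same objects and the unary morphisms. -/
structure Underlying (P : SymmOperad.{u}) where
  /-- the object of the operad -/
  ob : P.Ob

/-- The composition of unary morphisms. -/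
def unaryComp (P : SymmOperad.{u}) {a b c : P.Ob} (f : P.Hom (fun _ : Fin 1 => a) b)
    (g : P.Hom (fun _ : Fin 1 => b) c) : P.Hom (fun _ : Fin 1 => a) c :=
  P.act (oneBlockEquiv 1).symm (fun _ => rfl) (P.comp g (fun _ => f))

theorem act_self (P : SymmOperad.{u}) {n : ℕ} {c : Fin n → P.Ob} {p : P.Ob} (σ : Fin n ≃ Fin n)
    (hσ : σ = Equiv.refl _) (h : ∀ i, c i = c (σ i)) (ψ : P.Hom c p) : P.act σ h ψ = ψ := by
  subst hσ
  exact P.act_refl ψ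

theorem act_congr (P : SymmOperad.{u}) {n m : ℕ} {c : Fin m → P.Ob} {d : Fin n → P.Ob} {p : P.Ob}
    {σ τ : Fin n ≃ Fin m} (hστ : σ = τ) (hσ : ∀ i, d i = c (σ i)) (hτ : ∀ i, d i = c (τ i))
    (ψ : P.Hom c p) : P.act σ hσ ψ = P.act τ hτ ψ := by
  subst hστ
  rfl

instance (P : SymmOperad.{u}) : Category (Underlying P) where
  Hom a b := P.Hom (fun _ : Fin 1 => a.ob) b.ob
  id a := P.id a.ob
  comp f g := P.unaryComp f g
  id_comp {a b} f := (congrArg (P.act _ _) (P.comp_id f)).trans <|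
    (P.act_act _ _ _ _ f).trans (P.act_self _ (Subsingleton.elim _ _) _ _)
  comp_id {a b} f := (congrArg (P.act _ _) (P.id_comp f)).trans <|
    (P.act_act _ _ _ _ f).trans (P.act_self _ (Subsingleton.elim _ _) _ _)
  assoc {a b c d} f g h := by
    have h1 := P.act_comp (k := fun _ => 1) (d := fun _ _ => a.ob) (oneBlockEquiv 1).symm
      (P.comp h (fun _ => g)) (fun _ => f)
    have h2 := P.comp_act (fun _ : Fin 1 => (oneBlockEquiv 1).symm) h
      (fun _ => P.comp g (fun _ => f))
    have h3 := P.assoc (l := fun _ _ => 1) h (fun _ : Fin 1 => g) (fun _ _ => f)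
    have : Subsingleton (Fin (∑ _i : Fin 1, ∑ _j : Fin 1, 1)) := by
      simp only [Finset.univ_unique, Finset.sum_const, Finset.card_singleton, smul_eq_mul, mul_one]
      infer_instance
    have e2 := (congrArg (P.act (oneBlockEquiv 1).symm (fun _ => rfl)) h2).trans
      (P.act_act _ _ _ _ _)
    have e1 := (congrArg (P.act (oneBlockEquiv 1).symm (fun _ => rfl)) (h1.trans
      ((congrArg (P.act _ _) h3).trans (P.act_act _ _ _ _ _)))).trans (P.act_act _ _ _ _ _)
    exact (e1.trans ((P.act_congr (Equiv.ext fun x => Subsingleton.elim _ _) _ _ _).trans e2.symm)).symm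

/-- The functor between the underlying categories that is induced by a functor of operads. -/
def Functor.underlying {P Q : SymmOperad.{u}} (F : Functor P Q) : Underlying P ⥤ Underlying Q where
  obj a := ⟨F.obj a.ob⟩
  map f := F.map f
  map_id a := F.map_id a.ob
  map_comp f g := by
    refine (F.map_act _ _ _).trans ?_
    exact congrArg (Q.act _ _) (F.map_comp _ _)

/-! ## The three classes of functors -/

/-- The operadic equivalences: the essentially surjective and fully faithful functors. -/
def operadicEquivalences : MorphismProperty SymmOperad.{u} := fun P _ F =>
  (Functor.underlying F).EssSurj ∧
    ∀ (n : ℕ) (c : Fin n → P.Ob) (p : P.Ob),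
      Function.Bijective (fun ψ : P.Hom c p => Functor.map F ψ)

/-- The functors that are injective on objects. -/
def injectiveOnObjects : MorphismProperty SymmOperad.{u} := fun _ _ F =>
  Function.Injective (Functor.obj F)

/-- The functors that lift isomorphisms with a prescribed domain. -/
def isofibrations : MorphismProperty SymmOperad.{u} := fun P Q F =>
  ∀ (p : Underlying P) (q : Underlying Q) (ψ : (Functor.underlying F).obj p ≅ q),
    ∃ (p' : Underlying P) (φ : p ≅ p') (h : (Functor.underlying F).obj p' = q),
      (Functor.underlying F).mapIso φ ≪≫ eqToIso h = ψ

/-! ## Symmetric operads given by generators and relations -/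

section Presentation

variable {X : Type u} (Gen : ∀ ⦃n : ℕ⦄, (Fin n → X) → X → Type u)

/-- The formal composites of the generators `Gen`, of identities and of permutations. -/
inductive Term : ∀ {n : ℕ}, (Fin n → X) → X → Type u
  | gen {n : ℕ} {c : Fin n → X} {p : X} (g : Gen c p) : Term c p
  | id (p : X) : Term (fun _ : Fin 1 => p) p
  | comp {n : ℕ} {k : Fin n → ℕ} {c : Fin n → X} {d : ∀ i, Fin (k i) → X} {p : X}
      (t : Term c p) (s : ∀ i, Term (d i) (c i)) : Term (concat d) p
  | act {n m : ℕ} {c : Fin m → X} {d : Fin n → X} {p : X} (σ : Fin n ≃ Fin m)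
      (h : ∀ i, d i = c (σ i)) (t : Term c p) : Term d p

variable {Gen}
variable (rel : ∀ ⦃n : ℕ⦄ ⦃c : Fin n → X⦄ ⦃p : X⦄, Term Gen c p → Term Gen c p → Prop)

/-- The smallest congruence on the formal composites which contains the relations `rel` and the
axioms of a symmetric operad. -/
inductive Rel : ∀ {n : ℕ} {c : Fin n → X} {p : X}, Term Gen c p → Term Gen c p → Prop
  | of {n : ℕ} {c : Fin n → X} {p : X} {t t' : Term Gen c p} (h : rel t t') : Rel t t'
  | refl {n : ℕ} {c : Fin n → X} {p : X} (t : Term Gen c p) : Rel t t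
  | symm {n : ℕ} {c : Fin n → X} {p : X} {t t' : Term Gen c p} (h : Rel t t') : Rel t' t
  | trans {n : ℕ} {c : Fin n → X} {p : X} {t t' t'' : Term Gen c p}
      (h : Rel t t') (h' : Rel t' t'') : Rel t t''
  | comp_congr {n : ℕ} {k : Fin n → ℕ} {c : Fin n → X} {d : ∀ i, Fin (k i) → X} {p : X}
      {t t' : Term Gen c p} {s s' : ∀ i, Term Gen (d i) (c i)}
      (h : Rel t t') (h' : ∀ i, Rel (s i) (s' i)) : Rel (Term.comp t s) (Term.comp t' s')
  | act_congr {n m : ℕ} {c : Fin m → X} {d : Fin n → X} {p : X} (σ : Fin n ≃ Fin m)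
      (hσ : ∀ i, d i = c (σ i)) {t t' : Term Gen c p} (h : Rel t t') :
      Rel (Term.act σ hσ t) (Term.act σ hσ t')
  | act_refl {n : ℕ} {c : Fin n → X} {p : X} (t : Term Gen c p) :
      Rel (Term.act (Equiv.refl _) (fun _ => rfl) t) t
  | act_act {n m r : ℕ} {c : Fin r → X} {d : Fin m → X} {e : Fin n → X} {p : X}
      (σ : Fin m ≃ Fin r) (τ : Fin n ≃ Fin m) (hσ : ∀ i, d i = c (σ i))
      (hτ : ∀ i, e i = d (τ i)) (t : Term Gen c p) :
      Rel (Term.act τ hτ (Term.act σ hσ t))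
        (Term.act (τ.trans σ) (fun i => (hτ i).trans (hσ (τ i))) t)
  | id_comp {n : ℕ} {c : Fin n → X} {p : X} (t : Term Gen c p) :
      Rel (Term.comp (Term.id p) (fun _ => t)) (Term.act (oneBlockEquiv n) (fun _ => rfl) t)
  | comp_id {n : ℕ} {c : Fin n → X} {p : X} (t : Term Gen c p) :
      Rel (Term.comp t (fun i => Term.id (c i))) (Term.act (onesEquiv n) (fun _ => rfl) t)
  | assoc {n : ℕ} {k : Fin n → ℕ} {l : ∀ i, Fin (k i) → ℕ}
      {c : Fin n → X} {d : ∀ i, Fin (k i) → X} {e : ∀ i j, Fin (l i j) → X} {p : X}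
      (t : Term Gen c p) (s : ∀ i, Term Gen (d i) (c i))
      (r : ∀ i j, Term Gen (e i j) (d i j)) :
      Rel (Term.comp (Term.comp t s)
          (fun x => r (finSigmaFinEquiv.symm x).1 (finSigmaFinEquiv.symm x).2))
        (Term.act (assocEquiv k l) (concat_assoc e)
          (Term.comp t (fun i => Term.comp (s i) (r i))))
  | act_comp {n m : ℕ} {k : Fin m → ℕ} {c : Fin m → X} {d : ∀ j, Fin (k j) → X} {p : X}
      (σ : Fin n ≃ Fin m) (t : Term Gen c p) (s : ∀ j, Term Gen (d j) (c j)) :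
      Rel (Term.comp (Term.act (d := fun i => c (σ i)) σ (fun _ => rfl) t) (fun i => s (σ i)))
        (Term.act (outerEquiv σ k) (concat_blockEquiv _ _ _ (fun _ _ => rfl)) (Term.comp t s))
  | comp_act {n : ℕ} {k l : Fin n → ℕ} {c : Fin n → X} {d : ∀ i, Fin (l i) → X} {p : X}
      (τ : ∀ i, Fin (k i) ≃ Fin (l i)) (t : Term Gen c p) (s : ∀ i, Term Gen (d i) (c i)) :
      Rel (Term.comp t (fun i =>
          Term.act (d := fun j => d i (τ i j)) (τ i) (fun _ => rfl) (s i)))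
        (Term.act (innerEquiv τ) (concat_blockEquiv _ _ _ (fun _ _ => rfl)) (Term.comp t s))

/-- The congruence as an equivalence relation. -/
def relSetoid {n : ℕ} (c : Fin n → X) (p : X) : Setoid (Term Gen c p) where
  r := Rel rel
  iseqv := ⟨Rel.refl, Rel.symm, Rel.trans⟩

/-- The morphisms of the operad with generators `Gen` and relations `rel`. -/
abbrev PHom {n : ℕ} (c : Fin n → X) (p : X) : Type u := Quotient (relSetoid rel c p)

/-- The composition of classes of formal composites. -/
noncomputable def PHom.comp {n : ℕ} {k : Fin n → ℕ} {c : Fin n → X} {d : ∀ i, Fin (k i) → X}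
    {p : X} (ψ : PHom rel c p) (χ : ∀ i, PHom rel (d i) (c i)) : PHom rel (concat d) p :=
  Quotient.mk (relSetoid rel _ _) (Term.comp ψ.out (fun i => (χ i).out))

theorem PHom.comp_mk {n : ℕ} {k : Fin n → ℕ} {c : Fin n → X} {d : ∀ i, Fin (k i) → X}
    {p : X} (t : Term Gen c p) (s : ∀ i, Term Gen (d i) (c i)) :
    PHom.comp rel (Quotient.mk (relSetoid rel _ _) t)
      (fun i => Quotient.mk (relSetoid rel _ _) (s i)) =
    Quotient.mk (relSetoid rel _ _) (Term.comp t s) :=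
  Quotient.sound (Rel.comp_congr
    (Quotient.exact (Quotient.out_eq (Quotient.mk (relSetoid rel _ _) t)))
    (fun i => Quotient.exact (Quotient.out_eq (Quotient.mk (relSetoid rel _ _) (s i)))))

/-- The permutations of classes of formal composites. -/
def PHom.act {n m : ℕ} {c : Fin m → X} {d : Fin n → X} {p : X} (σ : Fin n ≃ Fin m)
    (h : ∀ i, d i = c (σ i)) (ψ : PHom rel c p) : PHom rel d p :=
  Quotient.map (Term.act σ h) (fun _ _ hh => Rel.act_congr σ h hh) ψ

/-- The symmetric operad with objects `X`, generators `Gen` and relations `rel`. -/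
noncomputable def presented : SymmOperad.{u} where
  Ob := X
  Hom c p := PHom rel c p
  id p := Quotient.mk (relSetoid rel _ _) (Term.id p)
  comp ψ χ := PHom.comp rel ψ χ
  act σ h ψ := PHom.act rel σ h ψ
  act_refl ψ := by
    induction ψ using Quotient.inductionOn with | h t => exact Quotient.sound (Rel.act_refl t)
  act_act σ τ hσ hτ ψ := by
    induction ψ using Quotient.inductionOn with
    | h t => exact Quotient.sound (Rel.act_act σ τ hσ hτ t)
  id_comp ψ := by
    induction ψ using Quotient.inductionOn with
    | h t => exact (PHom.comp_mk rel _ _).trans (Quotient.sound (Rel.id_comp t))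
  comp_id ψ := by
    induction ψ using Quotient.inductionOn with
    | h t => exact (PHom.comp_mk rel _ _).trans (Quotient.sound (Rel.comp_id t))
  assoc {n k l c d e p} ψ χ ω := by
    obtain ⟨t, rfl⟩ := Quotient.exists_rep ψ
    obtain ⟨s, rfl⟩ : ∃ s : ∀ i, Term Gen (d i) (c i),
        χ = fun i => Quotient.mk (relSetoid rel _ _) (s i) :=
      ⟨fun i => (χ i).out, funext fun i => (Quotient.out_eq (χ i)).symm⟩
    obtain ⟨r, rfl⟩ : ∃ r : ∀ i j, Term Gen (e i j) (d i j),
        ω = fun i j => Quotient.mk (relSetoid rel _ _) (r i j) :=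
      ⟨fun i j => (ω i j).out, funext fun i => funext fun j => (Quotient.out_eq (ω i j)).symm⟩
    simp only [PHom.comp_mk]
    exact Quotient.sound (Rel.assoc t s r)
  act_comp {n m k c d p} σ ψ χ := by
    obtain ⟨t, rfl⟩ := Quotient.exists_rep ψ
    obtain ⟨s, rfl⟩ : ∃ s : ∀ i, Term Gen (d i) (c i),
        χ = fun i => Quotient.mk (relSetoid rel _ _) (s i) :=
      ⟨fun i => (χ i).out, funext fun i => (Quotient.out_eq (χ i)).symm⟩
    rw [PHom.comp_mk]
    exact (PHom.comp_mk rel _ _).trans (Quotient.sound (Rel.act_comp σ t s))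
  comp_act {n k l c d p} τ ψ χ := by
    obtain ⟨t, rfl⟩ := Quotient.exists_rep ψ
    obtain ⟨s, rfl⟩ : ∃ s : ∀ i, Term Gen (d i) (c i),
        χ = fun i => Quotient.mk (relSetoid rel _ _) (s i) :=
      ⟨fun i => (χ i).out, funext fun i => (Quotient.out_eq (χ i)).symm⟩
    rw [PHom.comp_mk]
    exact (PHom.comp_mk rel _ _).trans (Quotient.sound (Rel.comp_act τ t s))

variable {R : SymmOperad.{u}} (f : X → R.Ob)
  (g : ∀ ⦃n : ℕ⦄ ⦃c : Fin n → X⦄ ⦃p : X⦄, Gen c p → R.Hom (fun i => f (c i)) (f p))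

/-- The value of a formal composite in an operad in which the generators are interpreted. -/
def Term.eval : ∀ {n : ℕ} {c : Fin n → X} {p : X}, Term Gen c p → R.Hom (fun i => f (c i)) (f p)
  | _, _, _, .gen a => g a
  | _, _, _, .id p => R.id (f p)
  | _, _, _, .comp t s => R.comp (Term.eval t) (fun i => Term.eval (s i))
  | _, _, _, .act σ h t => R.act σ (fun i => congrArg f (h i)) (Term.eval t)

theorem Rel.eval_eq
    (hg : ∀ ⦃n : ℕ⦄ ⦃c : Fin n → X⦄ ⦃p : X⦄ (t t' : Term Gen c p), rel t t' →
      Term.eval f g t = Term.eval f g t')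
    {n : ℕ} {c : Fin n → X} {p : X} {t t' : Term Gen c p} (h : Rel rel t t') :
    Term.eval f g t = Term.eval f g t' := by
  induction h with
  | of h => exact hg _ _ h
  | refl t => rfl
  | symm _ ih => exact ih.symm
  | trans _ _ ih ih' => exact ih.trans ih'
  | comp_congr _ _ ih ih' => exact congrArg₂ R.comp ih (funext ih')
  | act_congr σ hσ _ ih => exact congrArg (R.act σ _) ih
  | act_refl t => exact R.act_refl _
  | act_act σ τ hσ hτ t => exact R.act_act _ _ _ _ _
  | id_comp t => exact R.id_comp _
  | comp_id t => exact R.comp_id _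
  | assoc t s r =>
    exact R.assoc (Term.eval f g t) (fun i => Term.eval f g (s i))
      (fun i j => Term.eval f g (r i j))
  | act_comp σ t s => exact R.act_comp σ (Term.eval f g t) (fun j => Term.eval f g (s j))
  | comp_act τ t s => exact R.comp_act τ (Term.eval f g t) (fun j => Term.eval f g (s j))

/-- The universal property of generators and relations. -/
noncomputable def presentedLift
    (hg : ∀ ⦃n : ℕ⦄ ⦃c : Fin n → X⦄ ⦃p : X⦄ (t t' : Term Gen c p), rel t t' →
      Term.eval f g t = Term.eval f g t') : presented rel ⟶ R :=
  { obj := f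
    map := fun ψ => Quotient.lift (Term.eval f g) (fun _ _ h => Rel.eval_eq rel f g hg h) ψ
    map_id := fun _ => rfl
    map_comp := fun {n k c d p} ψ χ => by
      obtain ⟨t, rfl⟩ := Quotient.exists_rep ψ
      obtain ⟨s, rfl⟩ : ∃ s : ∀ i, Term Gen (d i) (c i),
          χ = fun i => Quotient.mk (relSetoid rel _ _) (s i) :=
        ⟨fun i => (χ i).out, funext fun i => (Quotient.out_eq (χ i)).symm⟩
      exact congrArg (Quotient.lift (Term.eval f g) (fun _ _ h => Rel.eval_eq rel f g hg h))
        (PHom.comp_mk rel t s)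
    map_act := fun σ h ψ => by
      obtain ⟨t, rfl⟩ := Quotient.exists_rep ψ
      rfl }

/-- The class of a generator. -/
def ofGen {n : ℕ} {c : Fin n → X} {p : X} (a : Gen c p) : (presented rel).Hom c p :=
  Quotient.mk (relSetoid rel _ _) (Term.gen a)

end Presentation

/-! ## The Boardman–Vogt tensor product -/

/-- The generators `ψ ⊗ q` and `p ⊗ φ` of the tensor product. -/
inductive BVGen (P Q : SymmOperad.{u}) :
    ∀ ⦃n : ℕ⦄, (Fin n → P.Ob × Q.Ob) → P.Ob × Q.Ob → Type u
  | left {n : ℕ} {c : Fin n → P.Ob} {p : P.Ob} (ψ : P.Hom c p) (q : Q.Ob) :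
      BVGen P Q (fun i => (c i, q)) (p, q)
  | right {n : ℕ} {c : Fin n → Q.Ob} {q : Q.Ob} (p : P.Ob) (φ : Q.Hom c q) :
      BVGen P Q (fun i => (p, c i)) (p, q)

/-- The generator `ψ ⊗ q` as a formal composite. -/
abbrev leftTerm {P Q : SymmOperad.{u}} {n : ℕ} {c : Fin n → P.Ob} {p : P.Ob} (ψ : P.Hom c p)
    (q : Q.Ob) : Term (BVGen P Q) (fun i => (c i, q)) (p, q) :=
  Term.gen (BVGen.left ψ q)

/-- The generator `p ⊗ φ` as a formal composite. -/
abbrev rightTerm {P Q : SymmOperad.{u}} {n : ℕ} {c : Fin n → Q.Ob} {q : Q.Ob} (p : P.Ob)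
    (φ : Q.Hom c q) : Term (BVGen P Q) (fun i => (p, c i)) (p, q) :=
  Term.gen (BVGen.right p φ)

/-- The relations of the tensor product: for each `q` the assignment `ψ ↦ ψ ⊗ q` is functorial, for
each `p` the assignment `φ ↦ p ⊗ φ` is functorial, and the two kinds of generators commute. -/
inductive BVRel (P Q : SymmOperad.{u}) :
    ∀ ⦃n : ℕ⦄ ⦃c : Fin n → P.Ob × Q.Ob⦄ ⦃x : P.Ob × Q.Ob⦄,
    Term (BVGen P Q) c x → Term (BVGen P Q) c x → Prop
  | left_id (p : P.Ob) (q : Q.Ob) : BVRel P Q (leftTerm (P.id p) q) (Term.id (p, q))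
  | left_comp {n : ℕ} {k : Fin n → ℕ} {c : Fin n → P.Ob} {d : ∀ i, Fin (k i) → P.Ob} {p : P.Ob}
      (ψ : P.Hom c p) (χ : ∀ i, P.Hom (d i) (c i)) (q : Q.Ob) :
      BVRel P Q (Term.comp (leftTerm ψ q) (fun i => leftTerm (χ i) q)) (leftTerm (P.comp ψ χ) q)
  | left_act {n m : ℕ} {c : Fin m → P.Ob} {d : Fin n → P.Ob} {p : P.Ob} (σ : Fin n ≃ Fin m)
      (h : ∀ i, d i = c (σ i)) (ψ : P.Hom c p) (q : Q.Ob) :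
      BVRel P Q (Term.act σ (fun i => congrArg (fun a => (a, q)) (h i)) (leftTerm ψ q))
        (leftTerm (P.act σ h ψ) q)
  | right_id (p : P.Ob) (q : Q.Ob) : BVRel P Q (rightTerm p (Q.id q)) (Term.id (p, q))
  | right_comp {n : ℕ} {k : Fin n → ℕ} {c : Fin n → Q.Ob} {d : ∀ i, Fin (k i) → Q.Ob} {q : Q.Ob}
      (p : P.Ob) (φ : Q.Hom c q) (χ : ∀ i, Q.Hom (d i) (c i)) :
      BVRel P Q (Term.comp (rightTerm p φ) (fun i => rightTerm p (χ i)))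
        (rightTerm p (Q.comp φ χ))
  | right_act {n m : ℕ} {c : Fin m → Q.Ob} {d : Fin n → Q.Ob} {q : Q.Ob} (σ : Fin n ≃ Fin m)
      (h : ∀ i, d i = c (σ i)) (p : P.Ob) (φ : Q.Hom c q) :
      BVRel P Q (Term.act σ (fun i => congrArg (fun b => (p, b)) (h i)) (rightTerm p φ))
        (rightTerm p (Q.act σ h φ))
  | interchange {n m : ℕ} {c : Fin n → P.Ob} {p : P.Ob} {d : Fin m → Q.Ob} {q : Q.Ob}
      (ψ : P.Hom c p) (φ : Q.Hom d q) :
      BVRel P Q (Term.comp (leftTerm ψ q) (fun i => rightTerm (c i) φ))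
        (Term.act (swapEquiv n m) (concat_blockEquiv _ _ _ (fun _ _ => rfl))
          (Term.comp (rightTerm p φ) (fun j => leftTerm ψ (d j))))

/-- The Boardman–Vogt tensor product of two symmetric operads. -/
noncomputable def bv (P Q : SymmOperad.{u}) : SymmOperad.{u} :=
  presented (BVRel P Q)

/-- The generators of the target which interpret the generators of the source. -/
def bvMapGen {P P' Q Q' : SymmOperad.{u}} (F : P ⟶ P') (G : Q ⟶ Q') :
    ∀ ⦃n : ℕ⦄ ⦃c : Fin n → P.Ob × Q.Ob⦄ ⦃x : P.Ob × Q.Ob⦄, BVGen P Q c x →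
      (bv P' Q').Hom (fun i => (Functor.obj F (c i).1, Functor.obj G (c i).2))
        (Functor.obj F x.1, Functor.obj G x.2)
  | _, _, _, .left ψ q =>
      ofGen (BVRel P' Q') (BVGen.left (Functor.map F ψ) (Functor.obj G q))
  | _, _, _, .right p φ =>
      ofGen (BVRel P' Q') (BVGen.right (Functor.obj F p) (Functor.map G φ))

/-- The tensor product `F ⊗ G` of two functors of symmetric operads: it is `F × G` on objects and
sends `ψ ⊗ q` to `F ψ ⊗ G q` and `p ⊗ φ` to `F p ⊗ G φ`. -/
noncomputable def bvMap {P P' Q Q' : SymmOperad.{u}} (F : P ⟶ P') (G : Q ⟶ Q') :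
    bv P Q ⟶ bv P' Q' :=
  presentedLift (BVRel P Q) (R := bv P' Q')
    (fun x => (Functor.obj F x.1, Functor.obj G x.2)) (bvMapGen F G) (by
      intro n c x t t' h
      cases h with
      | left_id p q =>
        refine Eq.trans ?_ (Quotient.sound (Rel.of (BVRel.left_id (Functor.obj F p)
          (Functor.obj G q))))
        exact congrArg (fun a => ofGen (BVRel P' Q') (BVGen.left a (Functor.obj G q)))
          (Functor.map_id F p)
      | left_comp ψ χ q =>
        refine (PHom.comp_mk _ _ _).trans ((Quotient.sound (Rel.of (BVRel.left_comp
          (Functor.map F ψ) (fun i => Functor.map F (χ i)) (Functor.obj G q)))).trans ?_)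
        exact congrArg (fun a => ofGen (BVRel P' Q') (BVGen.left a (Functor.obj G q)))
          (Functor.map_comp F ψ χ).symm
      | left_act σ h ψ q =>
        refine (Quotient.sound (Rel.of (BVRel.left_act σ (fun i => congrArg (Functor.obj F) (h i))
          (Functor.map F ψ) (Functor.obj G q)))).trans ?_
        exact congrArg (fun a => ofGen (BVRel P' Q') (BVGen.left a (Functor.obj G q)))
          (Functor.map_act F σ h ψ).symm
      | right_id p q =>
        refine Eq.trans ?_ (Quotient.sound (Rel.of (BVRel.right_id (Functor.obj F p)
          (Functor.obj G q))))
        exact congrArg (fun a => ofGen (BVRel P' Q') (BVGen.right (Functor.obj F p) a))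
          (Functor.map_id G q)
      | right_comp p φ χ =>
        refine (PHom.comp_mk _ _ _).trans ((Quotient.sound (Rel.of (BVRel.right_comp
          (Functor.obj F p) (Functor.map G φ) (fun i => Functor.map G (χ i))))).trans ?_)
        exact congrArg (fun a => ofGen (BVRel P' Q') (BVGen.right (Functor.obj F p) a))
          (Functor.map_comp G φ χ).symm
      | right_act σ h p φ =>
        refine (Quotient.sound (Rel.of (BVRel.right_act σ (fun i => congrArg (Functor.obj G) (h i))
          (Functor.obj F p) (Functor.map G φ)))).trans ?_
        exact congrArg (fun a => ofGen (BVRel P' Q') (BVGen.right (Functor.obj F p) a))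
          (Functor.map_act G σ h φ).symm
      | interchange ψ φ =>
        refine (PHom.comp_mk _ _ _).trans ((Quotient.sound (Rel.of (BVRel.interchange
          (Functor.map F ψ) (Functor.map G φ)))).trans ?_)
        exact congrArg (PHom.act _ _ _) (PHom.comp_mk _ _ _).symm)

/-- The operad with one object and only its identity morphism. -/
def star : SymmOperad.{u} where
  Ob := PUnit
  Hom {n} _ _ := ULift.{u} (PLift (n = 1))
  id _ := ⟨⟨rfl⟩⟩
  comp {n k c d p} ψ χ := ⟨⟨by
    have h := ψ.down.down
    simp only [fun i => (χ i).down.down, Finset.sum_const, Finset.card_univ, Fintype.card_fin, h,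
      smul_eq_mul, mul_one]⟩⟩
  act σ _ ψ := ⟨⟨(by simpa using Fintype.card_congr σ : _ = _).trans ψ.down.down⟩⟩
  act_refl _ := rfl
  act_act _ _ _ _ _ := rfl
  id_comp _ := rfl
  comp_id _ := rfl
  assoc _ _ _ := rfl
  act_comp _ _ _ := rfl
  comp_act _ _ _ := rfl

/-- The data of a monoidal structure with the Boardman–Vogt tensor product as its tensor product and
the operad `star` as its unit, for given associativity and unit isomorphisms. -/
@[reducible]
noncomputable def bvMonoidalStruct
    (α : ∀ P Q R : SymmOperad.{u}, bv (bv P Q) R ≅ bv P (bv Q R))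
    (l : ∀ P : SymmOperad.{u}, bv star P ≅ P) (r : ∀ P : SymmOperad.{u}, bv P star ≅ P) :
    MonoidalCategoryStruct SymmOperad.{u} where
  tensorObj := bv
  whiskerLeft P _ _ G := bvMap (𝟙 P) G
  whiskerRight F Q := bvMap F (𝟙 Q)
  tensorHom := bvMap
  tensorUnit := star
  associator := α
  leftUnitor := l
  rightUnitor := r

end SymmOperad

/-! ## Monoidal model categories -/

/-- A category with a monoidal structure and a model structure is a monoidal model category: it is
small complete and cocomplete, every object is cofibrant and the pushout-product axiom holds.
The pushout-product of `F` and `G` is the map `w` out of the pushout `K`. -/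
structure IsMonoidalModelCategory (C : Type u) [Category.{v} C] [MonoidalCategory C]
    [ModelCategory C] : Prop where
  hasLimits : HasLimits C
  hasColimits : HasColimits C
  isCofibrant : ∀ X : C, IsCofibrant X
  cofibration : ∀ {A B A' B' K : C} (F : A ⟶ B) (G : A' ⟶ B')
    (a : MonoidalCategoryStruct.tensorObj B A' ⟶ K)
    (b : MonoidalCategoryStruct.tensorObj A B' ⟶ K)
    (w : K ⟶ MonoidalCategoryStruct.tensorObj B B'),
    IsPushout (MonoidalCategoryStruct.whiskerRight F A')
      (MonoidalCategoryStruct.whiskerLeft A G) a b →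
    a ≫ w = MonoidalCategoryStruct.whiskerLeft B G →
    b ≫ w = MonoidalCategoryStruct.whiskerRight F B' →
    cofibrations C F → cofibrations C G → cofibrations C w
  trivialCofibration : ∀ {A B A' B' K : C} (F : A ⟶ B) (G : A' ⟶ B')
    (a : MonoidalCategoryStruct.tensorObj B A' ⟶ K)
    (b : MonoidalCategoryStruct.tensorObj A B' ⟶ K)
    (w : K ⟶ MonoidalCategoryStruct.tensorObj B B'),
    IsPushout (MonoidalCategoryStruct.whiskerRight F A')
      (MonoidalCategoryStruct.whiskerLeft A G) a b →
    a ≫ w = MonoidalCategoryStruct.whiskerLeft B G →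
    b ≫ w = MonoidalCategoryStruct.whiskerRight F B' →
    cofibrations C F → cofibrations C G → (weakEquivalences C F ∨ weakEquivalences C G) →
    trivialCofibrations C w

/-!
The theorem is proved by writing down everything explicitly; no transfinite construction is needed.

*Model structure.*  The argument is the one for the canonical model structure on categories.  A
functor `F : P ⟶ Q` can be replaced by an isomorphic one with prescribed values on objects (`conj`),
and a functor into `Q` lifts through a fully faithful functor as soon as its values on objects do
(`IsFullyFaithful.exists_lift`).  The trivial fibrations are the fully faithful functors that are
surjective on objects, so a lift against them is a lift on objects.  A trivial cofibration is the
inclusion of a strong deformation retract (`exists_retraction`), and a lift of it against an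
isofibration is obtained by conjugating the retraction with lifted isomorphisms.  The two
factorizations are given by the operad `pull Q [F, id]`, and by the operad of isomorphisms
`F p ≅ q` with the morphisms of `P`.

*Limits and colimits.*  Limits are computed by compatible families; a colimit is presented by the
morphisms of all operads in the diagram, with the evident relations.

*Monoidal structure.*  By its universal property, a functor out of `P ⊗ Q` is a pair of families of
functors, one for each variable, subject to the interchange law (`Bifunctor.lift`), and two functors
that agree in each variable are equal (`bv_hom_ext`).  With the latter all coherence conditions
hold by computation on generators.  The one point with content is the construction of the
associativity functor: in `P ⊗ (Q ⊗ R)` the interchange law with a morphism `φ` of `R` has to be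
known for all morphisms of `P ⊗ Q`.  It says that the values of `φ` are natural transformations of
several functors, and naturality passes from the generators to their composites
(`IsNaturalAt.comp`, `isNaturalAt_presented`).  The inverse is obtained by conjugating with the
symmetry.

*Pushout-products.*  On objects a tensor product is a cartesian product, and the two maps into a
pushout are jointly surjective; hence the pushout-product of two functors that are injective on
objects is again injective on objects.  The functor `- ⊗ Q` respects isomorphisms of functors
(`bvMap_conj`), so it preserves strong deformation retracts and therefore trivial cofibrations.
Since these are stable under pushout, two-out-of-three gives the remaining claim.
-/

-- Positions in a concatenation are compared by the labels they carry, never by computing them: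
-- unfolding this equivalence would only make unification expensive.
attribute [local irreducible] finSigmaFinEquiv

/-! ### Permutations determined by labels -/

namespace FinBlock

variable {X : Type u}

theorem concat_injective {n : ℕ} {k : Fin n → ℕ} {d : ∀ i, Fin (k i) → X}
    (h : Function.Injective fun z : Σ i, Fin (k i) => d z.1 z.2) :
    Function.Injective (concat d) :=
  h.comp finSigmaFinEquiv.symm.injective

/-- A permutation is determined by its effect on a list of pairwise different labels. -/
theorem equiv_eq_of_label {n m : ℕ} {σ τ : Fin n ≃ Fin m} {d : Fin n → X} {c : Fin m → X}
    (hc : Function.Injective c) (hσ : ∀ i, d i = c (σ i)) (hτ : ∀ i, d i = c (τ i)) : σ = τ :=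
  Equiv.ext fun i => hc ((hσ i).symm.trans (hτ i))

theorem concat_outerEquiv {n m : ℕ} (σ : Fin n ≃ Fin m) {k : Fin m → ℕ} (d : ∀ j, Fin (k j) → X)
    (x : Fin (∑ i, k (σ i))) : concat (fun i => d (σ i)) x = concat d (outerEquiv σ k x) :=
  concat_blockEquiv (Equiv.sigmaCongrLeft (β := fun j => Fin (k j)) σ) (fun i => d (σ i)) d
    (fun _ _ => rfl) x

theorem concat_innerEquiv_of_eq {n : ℕ} {k l : Fin n → ℕ} (τ : ∀ i, Fin (k i) ≃ Fin (l i))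
    {d' : ∀ i, Fin (k i) → X} {d : ∀ i, Fin (l i) → X} (h : ∀ i j, d' i j = d i (τ i j))
    (x : Fin (∑ i, k i)) : concat d' x = concat d (innerEquiv τ x) :=
  concat_blockEquiv (Equiv.sigmaCongrRight τ) d' d h x

theorem concat_innerEquiv {n : ℕ} {k l : Fin n → ℕ} (τ : ∀ i, Fin (k i) ≃ Fin (l i))
    (d : ∀ i, Fin (l i) → X) (x : Fin (∑ i, k i)) :
    concat (fun i j => d i (τ i j)) x = concat d (innerEquiv τ x) :=
  concat_blockEquiv (Equiv.sigmaCongrRight τ) (fun i j => d i (τ i j)) d (fun _ _ => rfl) x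

theorem concat_swapEquiv {n m : ℕ} (d : Fin n → Fin m → X) (x : Fin (∑ _i : Fin n, m)) :
    concat d x = concat (fun j i => d i j) (swapEquiv n m x) :=
  concat_blockEquiv _ d (fun j i => d i j) (fun _ _ => rfl) x

theorem concat_oneBlockEquiv {n : ℕ} (c : Fin n → X) (x : Fin (∑ _i : Fin 1, n)) :
    concat (fun _ => c) x = c (oneBlockEquiv n x) := rfl

theorem concat_onesEquiv {n : ℕ} (c : Fin n → X) (x : Fin (∑ _i : Fin n, 1)) :
    concat (fun i _ => c i) x = c (onesEquiv n x) := rfl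

theorem eq_concat_oneBlockEquiv_symm {n : ℕ} (c : Fin n → X) (x : Fin n) :
    c x = concat (fun _ : Fin 1 => c) ((oneBlockEquiv n).symm x) :=
  by rw [concat_oneBlockEquiv, Equiv.apply_symm_apply]

theorem eq_concat_onesEquiv_symm {n : ℕ} (c : Fin n → X) (x : Fin n) :
    c x = concat (fun i (_ : Fin 1) => c i) ((onesEquiv n).symm x) :=
  by rw [concat_onesEquiv, Equiv.apply_symm_apply]

/-- The tautological labels of the positions in a concatenation. -/
def label {n : ℕ} (k : Fin n → ℕ) : ∀ i, Fin (k i) → Σ i, Fin (k i) := fun i j => ⟨i, j⟩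

theorem label_injective {n : ℕ} (k : Fin n → ℕ) : Function.Injective (concat (label k)) :=
  concat_injective fun _ _ h => h

end FinBlock

namespace SymmOperad

/-! ### Elementary consequences of the axioms -/

section Basic

variable (P : SymmOperad.{u})

theorem act_symm_act {n m : ℕ} {c : Fin m → P.Ob} {d : Fin n → P.Ob} {p : P.Ob} (σ : Fin n ≃ Fin m)
    (h : ∀ i, d i = c (σ i)) (h' : ∀ i, c i = d (σ.symm i)) (ψ : P.Hom c p) :
    P.act σ.symm h' (P.act σ h ψ) = ψ :=
  (P.act_act _ _ _ _ _).trans (P.act_self _ (by simp) _ _)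

theorem act_act_symm {n m : ℕ} {c : Fin m → P.Ob} {d : Fin n → P.Ob} {p : P.Ob} (σ : Fin n ≃ Fin m)
    (h : ∀ i, d i = c (σ i)) (h' : ∀ i, c i = d (σ.symm i)) (ψ : P.Hom d p) :
    P.act σ h (P.act σ.symm h' ψ) = ψ :=
  (P.act_act _ _ _ _ _).trans (P.act_self _ (by simp) _ _)

theorem eq_of_act_eq {n m : ℕ} {c : Fin m → P.Ob} {d : Fin n → P.Ob} {p : P.Ob}
    {σ τ : Fin n ≃ Fin m} (hστ : σ = τ) {hσ : ∀ i, d i = c (σ i)} {hτ : ∀ i, d i = c (τ i)}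
    {ψ χ : P.Hom c p} (h : P.act σ hσ ψ = P.act τ hτ χ) : ψ = χ := by
  subst hστ
  have h' : ∀ i, c i = d (σ.symm i) := fun i => by simp [hσ]
  rw [← P.act_symm_act σ hσ h' ψ, h, P.act_symm_act]

/-- Composition respects heterogeneous equality, which arises whenever objects agree only
propositionally. -/
theorem heq_comp {n : ℕ} {k : Fin n → ℕ} {c c' : Fin n → P.Ob} {d d' : ∀ i, Fin (k i) → P.Ob}
    {p p' : P.Ob} {ψ : P.Hom c p} {ψ' : P.Hom c' p'} {χ : ∀ i, P.Hom (d i) (c i)}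
    {χ' : ∀ i, P.Hom (d' i) (c' i)} (hc : ∀ i, c i = c' i) (hd : ∀ i j, d i j = d' i j)
    (hp : p = p') (h : HEq ψ ψ') (h' : ∀ i, HEq (χ i) (χ' i)) :
    HEq (P.comp ψ χ) (P.comp ψ' χ') := by
  obtain rfl : c = c' := funext hc
  obtain rfl : d = d' := funext fun i => funext (hd i)
  subst hp
  obtain rfl := eq_of_heq h
  obtain rfl : χ = χ' := funext fun i => eq_of_heq (h' i)
  rfl

theorem heq_act {n m : ℕ} {c c' : Fin m → P.Ob} {d d' : Fin n → P.Ob} {p p' : P.Ob}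
    (σ : Fin n ≃ Fin m) {h : ∀ i, d i = c (σ i)} {h' : ∀ i, d' i = c' (σ i)}
    {ψ : P.Hom c p} {ψ' : P.Hom c' p'} (hc : ∀ i, c i = c' i) (hp : p = p') (hψ : HEq ψ ψ') :
    HEq (P.act σ h ψ) (P.act σ h' ψ') := by
  obtain rfl : c = c' := funext hc
  obtain rfl : d = fun i => c (σ i) := funext h
  obtain rfl : d' = fun i => c (σ i) := funext h'
  subst hp
  obtain rfl := eq_of_heq hψ
  rfl

/-- The axiom `act_comp`, with the domains and the inner morphisms given up to propositional
equality. -/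
theorem comp_act_left {n m : ℕ} {k : Fin m → ℕ} {c : Fin m → P.Ob} {c' : Fin n → P.Ob}
    {d : ∀ j, Fin (k j) → P.Ob} {p : P.Ob} (σ : Fin n ≃ Fin m) (h : ∀ i, c' i = c (σ i))
    (ψ : P.Hom c p) (χ : ∀ j, P.Hom (d j) (c j)) (χ' : ∀ i, P.Hom (d (σ i)) (c' i))
    (hχ : ∀ i, HEq (χ' i) (χ (σ i))) :
    P.comp (P.act σ h ψ) χ' = P.act (outerEquiv σ k) (concat_outerEquiv σ d) (P.comp ψ χ) := by
  obtain rfl : c' = fun i => c (σ i) := funext h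
  obtain rfl : χ' = fun i => χ (σ i) := funext fun i => eq_of_heq (hχ i)
  exact P.act_comp σ ψ χ

/-- The axiom `comp_act`, with the domains given up to propositional equality. -/
theorem comp_act_right {n : ℕ} {k l : Fin n → ℕ} {c : Fin n → P.Ob} {d : ∀ i, Fin (l i) → P.Ob}
    {d' : ∀ i, Fin (k i) → P.Ob} {p : P.Ob} (τ : ∀ i, Fin (k i) ≃ Fin (l i))
    (h : ∀ i j, d' i j = d i (τ i j)) (ψ : P.Hom c p) (χ : ∀ i, P.Hom (d i) (c i)) :
    P.comp ψ (fun i => P.act (τ i) (h i) (χ i)) =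
      P.act (innerEquiv τ) (concat_innerEquiv_of_eq τ h) (P.comp ψ χ) := by
  obtain rfl : d' = fun i j => d i (τ i j) := funext fun i => funext (h i)
  exact P.comp_act τ ψ χ

/-- The composition of a morphism with a unary morphism out of its target. -/
def post {n : ℕ} {c : Fin n → P.Ob} {a b : P.Ob} (ψ : P.Hom c a)
    (f : P.Hom (fun _ : Fin 1 => a) b) : P.Hom c b :=
  P.act (oneBlockEquiv n).symm (eq_concat_oneBlockEquiv_symm c)
    (P.comp f (fun _ => ψ))

/-- The composition of a morphism with unary morphisms into the objects of its domain. -/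
def pre {n : ℕ} {c d : Fin n → P.Ob} {a : P.Ob} (g : ∀ i, P.Hom (fun _ : Fin 1 => d i) (c i))
    (ψ : P.Hom c a) : P.Hom d a :=
  P.act (onesEquiv n).symm (eq_concat_onesEquiv_symm d)
    (P.comp ψ g)

theorem comp_eq_post {n : ℕ} {c : Fin n → P.Ob} {a b : P.Ob} (ψ : P.Hom c a)
    (f : P.Hom (fun _ : Fin 1 => a) b) :
    P.comp f (fun _ => ψ) = P.act (oneBlockEquiv n) (concat_oneBlockEquiv c) (P.post ψ f) :=
  (P.act_act_symm _ _ _ _).symm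

theorem comp_eq_pre {n : ℕ} {c d : Fin n → P.Ob} {a : P.Ob}
    (g : ∀ i, P.Hom (fun _ : Fin 1 => d i) (c i)) (ψ : P.Hom c a) :
    P.comp ψ g = P.act (onesEquiv n) (concat_onesEquiv d) (P.pre g ψ) :=
  (P.act_act_symm _ _ _ _).symm

theorem post_act {n m : ℕ} {c : Fin m → P.Ob} {d : Fin n → P.Ob} {a b : P.Ob} (σ : Fin n ≃ Fin m)
    (h : ∀ i, d i = c (σ i)) (ψ : P.Hom c a) (f : P.Hom (fun _ : Fin 1 => a) b) :
    P.post (P.act σ h ψ) f = P.act σ h (P.post ψ f) := by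
  obtain rfl : d = fun i => c (σ i) := funext h
  have h1 := P.comp_act_right (fun _ : Fin 1 => σ) (fun _ => h) f (fun _ => ψ)
  rw [comp_eq_post, comp_eq_post, act_act] at h1
  refine P.eq_of_act_eq (σ := oneBlockEquiv n) rfl
    (hσ := concat_oneBlockEquiv fun i => c (σ i)) (hτ := concat_oneBlockEquiv fun i => c (σ i)) ?_
  refine h1.trans ((P.act_congr ?_ _ _ _).trans (P.act_act _ _ _ _ _).symm)
  exact equiv_eq_of_label (c := fun x => x) (d := fun x => σ (oneBlockEquiv n x)) (fun _ _ h => h)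
    (fun x => concat_innerEquiv (fun _ : Fin 1 => σ) (fun _ x => x) x) (fun _ => rfl)

theorem pre_act {n m : ℕ} {c d : Fin m → P.Ob} {c' : Fin n → P.Ob} {a : P.Ob} (σ : Fin n ≃ Fin m)
    (h : ∀ i, c' i = c (σ i)) {d' : Fin n → P.Ob} (h' : ∀ i, d' i = d (σ i)) (ψ : P.Hom c a)
    (g : ∀ i, P.Hom (fun _ : Fin 1 => d i) (c i)) (g' : ∀ i, P.Hom (fun _ : Fin 1 => d' i) (c' i))
    (hg : ∀ i, HEq (g' i) (g (σ i))) :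
    P.pre g' (P.act σ h ψ) = P.act σ h' (P.pre g ψ) := by
  obtain rfl : c' = fun i => c (σ i) := funext h
  obtain rfl : d' = fun i => d (σ i) := funext h'
  have h1 := P.comp_act_left σ h ψ g _ hg
  rw [comp_eq_pre, comp_eq_pre, act_act] at h1
  refine P.eq_of_act_eq (σ := onesEquiv n) rfl
    (hσ := concat_onesEquiv fun i => d (σ i)) (hτ := concat_onesEquiv fun i => d (σ i)) ?_
  refine h1.trans ((P.act_congr ?_ _ _ _).trans (P.act_act _ _ _ _ _).symm)
  exact equiv_eq_of_label (c := fun x => x) (d := fun x => σ (onesEquiv n x)) (fun _ _ h => h)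
    (fun x => concat_outerEquiv (k := fun _ => 1) σ (fun i _ => i) x) (fun _ => rfl)

theorem comp_post {n : ℕ} {k : Fin n → ℕ} {c : Fin n → P.Ob} {d : ∀ i, Fin (k i) → P.Ob}
    {a b : P.Ob} (ψ : P.Hom c a) (χ : ∀ i, P.Hom (d i) (c i)) (f : P.Hom (fun _ : Fin 1 => a) b) :
    P.comp (P.post ψ f) χ = P.post (P.comp ψ χ) f := by
  have h1 := P.assoc f (fun _ => ψ) (fun _ => χ)
  rw [comp_eq_post, comp_eq_post, act_act] at h1
  have h2 := (P.comp_act_left (oneBlockEquiv n) (concat_oneBlockEquiv c) (P.post ψ f) χ _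
    fun _ => HEq.rfl).symm.trans h1
  refine P.eq_of_act_eq ?_ h2
  exact equiv_eq_of_label (label_injective k) (concat_outerEquiv (oneBlockEquiv n) (label k))
    (fun x => (concat_assoc (k := fun _ => n) (l := fun _ => k) (fun _ : Fin 1 => label k) x).trans
      (concat_oneBlockEquiv (concat (label k)) (assocEquiv (fun _ : Fin 1 => n) (fun _ => k) x)))

theorem comp_pre_left {n : ℕ} {k : Fin n → ℕ} {c c' : Fin n → P.Ob} {d : ∀ i, Fin (k i) → P.Ob}
    {a : P.Ob} (ψ : P.Hom c a) (g : ∀ i, P.Hom (fun _ : Fin 1 => c' i) (c i))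
    (χ : ∀ i, P.Hom (d i) (c' i)) :
    P.comp (P.pre g ψ) χ = P.comp ψ (fun i => P.post (χ i) (g i)) := by
  have h1 := P.assoc ψ g (fun i _ => χ i)
  simp only [comp_eq_post] at h1
  rw [P.comp_act_right (fun i => oneBlockEquiv (k i)) _ ψ (fun i => P.post (χ i) (g i)),
    comp_eq_pre, act_act] at h1
  have h2 := (P.comp_act_left (onesEquiv n) (concat_onesEquiv c') (P.pre g ψ) χ _
    fun _ => HEq.rfl).symm.trans h1
  refine P.eq_of_act_eq ?_ h2
  exact equiv_eq_of_label (label_injective k) (concat_outerEquiv _ _)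
    (fun x => (concat_assoc (fun i _ => label k i) x).trans
      (concat_innerEquiv_of_eq _ (fun i => concat_oneBlockEquiv (label k i)) _))

theorem comp_pre {n : ℕ} {k : Fin n → ℕ} {c : Fin n → P.Ob} {d d' : ∀ i, Fin (k i) → P.Ob}
    {a : P.Ob} (ψ : P.Hom c a) (χ : ∀ i, P.Hom (d i) (c i))
    (g : ∀ i j, P.Hom (fun _ : Fin 1 => d' i j) (d i j)) :
    P.comp ψ (fun i => P.pre (g i) (χ i)) =
      P.pre (fun x => g (finSigmaFinEquiv.symm x).1 (finSigmaFinEquiv.symm x).2) (P.comp ψ χ) := by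
  have h1 := P.assoc ψ χ g
  simp only [comp_eq_pre] at h1
  rw [P.comp_act_right (fun i => onesEquiv (k i)) _ ψ (fun i => P.pre (g i) (χ i)), act_act] at h1
  refine P.eq_of_act_eq ?_ h1.symm
  exact equiv_eq_of_label (label_injective k)
    (fun x => (concat_assoc (fun i j (_ : Fin 1) => label k i j) x).trans
      (concat_innerEquiv_of_eq _ (fun i => concat_onesEquiv (label k i)) _))
    (fun _ => rfl)

theorem post_post {n : ℕ} {c : Fin n → P.Ob} {a b e : P.Ob} (ψ : P.Hom c a)
    (f : P.Hom (fun _ : Fin 1 => a) b) (g : P.Hom (fun _ : Fin 1 => b) e) :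
    P.post (P.post ψ f) g = P.post ψ (P.post f g) := by
  have h := P.comp_post f (fun _ => ψ) g
  rw [comp_eq_post, comp_eq_post, post_act] at h
  exact P.eq_of_act_eq rfl h.symm

theorem pre_pre {n : ℕ} {c d e : Fin n → P.Ob} {a : P.Ob}
    (g : ∀ i, P.Hom (fun _ : Fin 1 => d i) (c i)) (h : ∀ i, P.Hom (fun _ : Fin 1 => e i) (d i))
    (ψ : P.Hom c a) : P.pre h (P.pre g ψ) = P.pre (fun i => P.post (h i) (g i)) ψ := by
  have h := P.comp_pre_left ψ g h
  rw [comp_eq_pre, comp_eq_pre] at h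
  exact P.eq_of_act_eq rfl h

theorem pre_post {n : ℕ} {c d : Fin n → P.Ob} {a b : P.Ob}
    (g : ∀ i, P.Hom (fun _ : Fin 1 => d i) (c i)) (ψ : P.Hom c a)
    (f : P.Hom (fun _ : Fin 1 => a) b) :
    P.pre g (P.post ψ f) = P.post (P.pre g ψ) f := by
  have h := P.comp_post ψ g f
  rw [comp_eq_pre, comp_eq_pre, post_act] at h
  exact P.eq_of_act_eq rfl h

theorem post_id {n : ℕ} {c : Fin n → P.Ob} {a : P.Ob} (ψ : P.Hom c a) : P.post ψ (P.id a) = ψ :=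
  P.eq_of_act_eq rfl ((P.comp_eq_post _ _).symm.trans (P.id_comp ψ))

theorem pre_id {n : ℕ} {c : Fin n → P.Ob} {a : P.Ob} (ψ : P.Hom c a) :
    P.pre (fun i => P.id (c i)) ψ = ψ :=
  P.eq_of_act_eq rfl ((P.comp_eq_pre _ _).symm.trans (P.comp_id ψ))

end Basic

theorem Functor.map_post {P Q : SymmOperad.{u}} (F : Functor P Q) {n : ℕ} {c : Fin n → P.Ob}
    {a b : P.Ob} (ψ : P.Hom c a) (f : P.Hom (fun _ : Fin 1 => a) b) :
    F.map (P.post ψ f) = Q.post (F.map ψ) (F.map f) :=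
  (F.map_act _ _ _).trans (congrArg (Q.act _ _) (F.map_comp _ _))

theorem Functor.map_pre {P Q : SymmOperad.{u}} (F : Functor P Q) {n : ℕ} {c d : Fin n → P.Ob}
    {a : P.Ob} (g : ∀ i, P.Hom (fun _ : Fin 1 => d i) (c i)) (ψ : P.Hom c a) :
    F.map (P.pre g ψ) = Q.pre (d := fun i => F.obj (d i)) (fun i => F.map (g i)) (F.map ψ) :=
  (F.map_act _ _ _).trans (congrArg (Q.act _ _) (F.map_comp _ _))

/-! ### Equality of functors -/

theorem functor_ext {P Q : SymmOperad.{u}} {F G : P ⟶ Q}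
    (ho : ∀ p, Functor.obj F p = Functor.obj G p)
    (hm : ∀ {n : ℕ} {c : Fin n → P.Ob} {p : P.Ob} (ψ : P.Hom c p),
      HEq (Functor.map F ψ) (Functor.map G ψ)) : F = G := by
  obtain ⟨fo, fm, _, _, _⟩ := F
  obtain ⟨go, gm, _, _, _⟩ := G
  obtain rfl : fo = go := funext ho
  obtain rfl : @fm = @gm := by
    funext n c p ψ
    exact eq_of_heq (hm ψ)
  rfl

theorem heq_map_of_eq {P Q : SymmOperad.{u}} {F G : P ⟶ Q} (h : F = G) {n : ℕ} {c : Fin n → P.Ob}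
    {p : P.Ob} (ψ : P.Hom c p) : HEq (Functor.map F ψ) (Functor.map G ψ) := by
  subst h
  rfl

theorem heq_map {P Q : SymmOperad.{u}} (F : P ⟶ Q) {n : ℕ} {c c' : Fin n → P.Ob} {p p' : P.Ob}
    {ψ : P.Hom c p} {ψ' : P.Hom c' p'} (hc : ∀ i, c i = c' i) (hp : p = p') (h : HEq ψ ψ') :
    HEq (Functor.map F ψ) (Functor.map F ψ') := by
  obtain rfl : c = c' := funext hc
  subst hp
  obtain rfl := eq_of_heq h
  rfl

theorem obj_of_eq {P Q : SymmOperad.{u}} {F G : P ⟶ Q} (h : F = G) (p : P.Ob) :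
    Functor.obj F p = Functor.obj G p := by
  rw [h]

/-- A faithful functor can be cancelled from the right, for functors that agree on objects. -/
theorem functor_ext_of_faithful {B X Y : SymmOperad.{u}} {L L' : B ⟶ X} (F : X ⟶ Y)
    (hF : ∀ {n : ℕ} (c : Fin n → X.Ob) (p : X.Ob),
      Function.Injective fun ψ : X.Hom c p => Functor.map F ψ)
    (ho : ∀ b, Functor.obj L b = Functor.obj L' b) (h : L ≫ F = L' ≫ F) : L = L' := by
  obtain ⟨lo, lm, _, _, _⟩ := L
  obtain ⟨mo, mm, _, _, _⟩ := L'
  obtain rfl : lo = mo := funext ho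
  refine functor_ext (fun _ => rfl) fun ψ => heq_of_eq (hF _ _ ?_)
  exact eq_of_heq (heq_map_of_eq h ψ)

/-! ### Fully faithful functors -/

/-- A functor is fully faithful if it is bijective on all sets of morphisms. -/
def IsFullyFaithful {P Q : SymmOperad.{u}} (F : P ⟶ Q) : Prop :=
  ∀ (n : ℕ) (c : Fin n → P.Ob) (p : P.Ob),
    Function.Bijective (fun ψ : P.Hom c p => Functor.map F ψ)

theorem IsFullyFaithful.comp {P Q R : SymmOperad.{u}} {F : P ⟶ Q} {G : Q ⟶ R}
    (hF : IsFullyFaithful F) (hG : IsFullyFaithful G) : IsFullyFaithful (F ≫ G) :=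
  fun n c p => (hG n _ _).comp (hF n c p)

theorem IsFullyFaithful.of_comp_right {P Q R : SymmOperad.{u}} {F : P ⟶ Q} {G : Q ⟶ R}
    (hFG : IsFullyFaithful (F ≫ G)) (hG : IsFullyFaithful G) : IsFullyFaithful F :=
  fun n c p => (Function.Bijective.of_comp_iff' (hG n _ _) _).1 (hFG n c p)

theorem isFullyFaithful_id (P : SymmOperad.{u}) : IsFullyFaithful (𝟙 P) :=
  fun _ _ _ => Function.bijective_id

/-- A functor lifts through a fully faithful functor as soon as its values on objects lift. -/
theorem IsFullyFaithful.exists_lift {B X Y : SymmOperad.{u}} {F : X ⟶ Y} (hF : IsFullyFaithful F)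
    (V : B ⟶ Y) (l : B.Ob → X.Ob) (hl : ∀ b, Functor.obj F (l b) = Functor.obj V b) :
    ∃ L : B ⟶ X, Functor.obj L = l ∧ L ≫ F = V := by
  obtain ⟨vo, vm, vid, vcomp, vact⟩ := V
  obtain rfl : (fun b => Functor.obj F (l b)) = vo := funext hl
  let e : ∀ {n : ℕ} (c : Fin n → X.Ob) (p : X.Ob), X.Hom c p ≃ _ :=
    fun c p => Equiv.ofBijective _ (hF _ c p)
  have he : ∀ {n : ℕ} {c : Fin n → X.Ob} {p : X.Ob} (χ : Y.Hom _ _),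
      Functor.map F ((e c p).symm χ) = χ := fun χ => (e _ _).apply_symm_apply χ
  refine ⟨⟨l, fun ψ => (e _ _).symm (vm ψ), fun p => ?_, fun {n k c d p} ψ χ => ?_,
    fun σ h ψ => ?_⟩, rfl, ?_⟩
  · apply (hF _ _ _).1
    exact (he _).trans ((vid p).trans (Functor.map_id F _).symm)
  · apply (hF _ _ _).1
    refine (he _).trans ((vcomp ψ χ).trans (Eq.trans ?_ (Functor.map_comp F
      (d := fun i j => l (d i j)) ((e _ _).symm (vm ψ)) fun i => (e _ _).symm (vm (χ i))).symm))
    exact (congrArg₂ Y.comp (he _) (funext fun i => he _)).symm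
  · apply (hF _ _ _).1
    refine (he _).trans ((vact σ h ψ).trans ((Functor.map_act F _ _ _).trans ?_).symm)
    exact congrArg (Y.act _ _) (he _)
  · exact functor_ext (fun _ => rfl) fun ψ => heq_of_eq (he _)

/-- The operad with objects `S` whose morphisms are those of `Q` between the values of `f`. -/
def pull (Q : SymmOperad.{u}) {S : Type u} (f : S → Q.Ob) : SymmOperad.{u} where
  Ob := S
  Hom c p := Q.Hom (fun i => f (c i)) (f p)
  id p := Q.id (f p)
  comp ψ χ := Q.comp ψ χ
  act σ h ψ := Q.act σ (fun i => congrArg f (h i)) ψ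
  act_refl ψ := Q.act_refl ψ
  act_act σ τ _ _ ψ := Q.act_act σ τ _ _ ψ
  id_comp ψ := Q.id_comp ψ
  comp_id ψ := Q.comp_id ψ
  assoc ψ χ ω := Q.assoc ψ χ ω
  act_comp σ ψ χ := Q.act_comp σ ψ χ
  comp_act τ ψ χ := Q.comp_act τ ψ χ

/-- The fully faithful functor from `pull Q f` to `Q`. -/
def pullMap (Q : SymmOperad.{u}) {S : Type u} (f : S → Q.Ob) : pull Q f ⟶ Q :=
  { obj := f
    map := fun ψ => ψ
    map_id := fun _ => rfl
    map_comp := fun _ _ => rfl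
    map_act := fun _ _ _ => rfl }

theorem isFullyFaithful_pullMap (Q : SymmOperad.{u}) {S : Type u} (f : S → Q.Ob) :
    IsFullyFaithful (pullMap Q f) :=
  fun _ _ _ => Function.bijective_id

/-- The operad with objects `S` and exactly one morphism for each domain and each target. -/
def chaotic (S : Type u) : SymmOperad.{u} where
  Ob := S
  Hom _ _ := PUnit
  id _ := ⟨⟩
  comp _ _ := ⟨⟩
  act _ _ _ := ⟨⟩
  act_refl _ := rfl
  act_act _ _ _ _ _ := rfl
  id_comp _ := rfl
  comp_id _ := rfl
  assoc _ _ _ := rfl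
  act_comp _ _ _ := rfl
  comp_act _ _ _ := rfl

/-- The functor to a chaotic operad that is given by a function on objects. -/
def toChaotic (P : SymmOperad.{u}) {S : Type u} (f : P.Ob → S) : P ⟶ chaotic S :=
  { obj := f
    map := fun _ => ⟨⟩
    map_id := fun _ => rfl
    map_comp := fun _ _ => rfl
    map_act := fun _ _ _ => rfl }

/-! ### Transport of morphisms and of functors along isomorphisms -/

section Conj

variable (P : SymmOperad.{u})

/-- An isomorphism of `P` between two objects, as an isomorphism in the underlying category. -/
abbrev ObIso (a b : P.Ob) : Type u := (⟨a⟩ : Underlying P) ≅ ⟨b⟩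

variable {P}

theorem post_hom_inv {a b : P.Ob} (f : ObIso P a b) : P.post f.hom f.inv = P.id a := f.hom_inv_id

theorem post_inv_hom {a b : P.Ob} (f : ObIso P a b) : P.post f.inv f.hom = P.id b := f.inv_hom_id

theorem pre_unary {a b c : P.Ob} (g : P.Hom (fun _ : Fin 1 => a) b)
    (f : P.Hom (fun _ : Fin 1 => b) c) : P.pre (fun _ => g) f = P.post g f :=
  P.act_congr (Subsingleton.elim _ _) _ _ _

/-- The bijection between sets of morphisms that is given by isomorphisms between the domains and
between the targets. -/
def conjEquiv {n : ℕ} {c d : Fin n → P.Ob} {p q : P.Ob} (a : ∀ i, ObIso P (c i) (d i))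
    (b : ObIso P p q) : P.Hom c p ≃ P.Hom d q where
  toFun ψ := P.pre (fun i => (a i).inv) (P.post ψ b.hom)
  invFun χ := P.pre (fun i => (a i).hom) (P.post χ b.inv)
  left_inv ψ := by
    beta_reduce
    rw [← P.pre_post, P.post_post, P.pre_pre, post_hom_inv, P.post_id]
    simp only [post_hom_inv, P.pre_id]
  right_inv χ := by
    beta_reduce
    rw [← P.pre_post, P.post_post, P.pre_pre, post_inv_hom, P.post_id]
    simp only [post_inv_hom, P.pre_id]

theorem conjEquiv_apply {n : ℕ} {c d : Fin n → P.Ob} {p q : P.Ob} (a : ∀ i, ObIso P (c i) (d i))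
    (b : ObIso P p q) (ψ : P.Hom c p) :
    conjEquiv a b ψ = P.pre (fun i => (a i).inv) (P.post ψ b.hom) := rfl

theorem conjEquiv_unary_id {p q r : P.Ob} (a : ObIso P p q) (b : ObIso P p r) :
    conjEquiv (fun _ => a) b (P.id p) = P.post a.inv b.hom := by
  rw [conjEquiv_apply, pre_unary]
  exact congrArg (P.post a.inv) ((pre_unary (P.id p) b.hom).symm.trans (P.pre_id b.hom))

theorem conjEquiv_id {p q : P.Ob} (b : ObIso P p q) : conjEquiv (fun _ => b) b (P.id p) = P.id q :=
  (conjEquiv_unary_id b b).trans (post_inv_hom b)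

theorem conjEquiv_comp {n : ℕ} {k : Fin n → ℕ} {c c' : Fin n → P.Ob} {d d' : ∀ i, Fin (k i) → P.Ob}
    {p q : P.Ob} (ψ : P.Hom c p) (χ : ∀ i, P.Hom (d i) (c i)) (a : ∀ i, ObIso P (c i) (c' i))
    (a' : ∀ i j, ObIso P (d i j) (d' i j)) (b : ObIso P p q) :
    P.comp (conjEquiv a b ψ) (fun i => conjEquiv (a' i) (a i) (χ i)) =
      conjEquiv (c := concat d) (d := concat d')
        (fun x => a' (finSigmaFinEquiv.symm x).1 (finSigmaFinEquiv.symm x).2) b (P.comp ψ χ) := by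
  simp only [conjEquiv_apply]
  rw [P.comp_pre_left]
  simp only [← P.pre_post, P.post_post, post_hom_inv, P.post_id]
  rw [P.comp_pre, P.comp_post]

theorem conjEquiv_act {n m : ℕ} {c d : Fin m → P.Ob} {c' d' : Fin n → P.Ob} {p q : P.Ob}
    (σ : Fin n ≃ Fin m) (h : ∀ i, c' i = c (σ i)) (h' : ∀ i, d' i = d (σ i)) (ψ : P.Hom c p)
    (a : ∀ i, ObIso P (c i) (d i)) (a' : ∀ i, ObIso P (c' i) (d' i))
    (ha : ∀ i, HEq (a' i).inv (a (σ i)).inv) (b : ObIso P p q) :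
    conjEquiv a' b (P.act σ h ψ) = P.act σ h' (conjEquiv a b ψ) := by
  rw [conjEquiv_apply, conjEquiv_apply, P.post_act, P.pre_act σ h h' _ (fun i => (a i).inv) _ ha]

theorem conjEquiv_refl {n : ℕ} {c : Fin n → P.Ob} {p : P.Ob} (ψ : P.Hom c p) :
    conjEquiv (fun _ => Iso.refl _) (Iso.refl _) ψ = ψ :=
  (congrArg (P.pre _) (P.post_id ψ)).trans (P.pre_id ψ)

/-- The image of an isomorphism under a functor. -/
def mapObIso {Q : SymmOperad.{u}} (F : P ⟶ Q) {a b : P.Ob} (f : ObIso P a b) :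
    ObIso Q (Functor.obj F a) (Functor.obj F b) :=
  (Functor.underlying F).mapIso f

theorem map_conjEquiv {Q : SymmOperad.{u}} (F : P ⟶ Q) {n : ℕ} {c d : Fin n → P.Ob} {p q : P.Ob}
    (a : ∀ i, ObIso P (c i) (d i)) (b : ObIso P p q) (ψ : P.Hom c p) :
    Functor.map F (conjEquiv a b ψ) =
      conjEquiv (fun i => mapObIso F (a i)) (mapObIso F b) (Functor.map F ψ) :=
  (Functor.map_pre F _ _).trans (congrArg (Q.pre _) (Functor.map_post F _ _))

variable {Q : SymmOperad.{u}}

/-- The functor with given values `l p` on objects which is isomorphic to `F` by given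
isomorphisms `θ p` from `F p` to `l p`. -/
def conj (F : P ⟶ Q) (l : P.Ob → Q.Ob) (θ : ∀ p, ObIso Q (Functor.obj F p) (l p)) : P ⟶ Q :=
  { obj := l
    map := fun {_ c p} ψ => conjEquiv (fun i => θ (c i)) (θ p) (Functor.map F ψ)
    map_id := fun p => (congrArg _ (Functor.map_id F p)).trans (conjEquiv_id (θ p))
    map_comp := fun {n k c d p} ψ χ => (congrArg _ (Functor.map_comp F ψ χ)).trans
      (conjEquiv_comp (Functor.map F ψ) (fun i => Functor.map F (χ i)) (fun i => θ (c i))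
        (fun i j => θ (d i j)) (θ p)).symm
    map_act := fun {n m c d p} σ h ψ => (congrArg _ (Functor.map_act F σ h ψ)).trans
      (conjEquiv_act σ _ _ _ _ _ (fun i => by rw [h i]) _) }

theorem conj_comp {R : SymmOperad.{u}} (F : P ⟶ Q) (l : P.Ob → Q.Ob)
    (θ : ∀ p, ObIso Q (Functor.obj F p) (l p)) (G : Q ⟶ R) :
    conj F l θ ≫ G = conj (F ≫ G) (fun p => Functor.obj G (l p)) (fun p => mapObIso G (θ p)) :=
  functor_ext (fun _ => rfl) fun _ => heq_of_eq (map_conjEquiv G _ _ _)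

theorem comp_conj {R : SymmOperad.{u}} (E : R ⟶ P) (F : P ⟶ Q) (l : P.Ob → Q.Ob)
    (θ : ∀ p, ObIso Q (Functor.obj F p) (l p)) :
    E ≫ conj F l θ = conj (E ≫ F) (fun r => l (Functor.obj E r)) (fun r => θ (Functor.obj E r)) :=
  rfl

theorem conj_eqToIso (F : P ⟶ Q) (l : P.Ob → Q.Ob) (θ : ∀ p, ObIso Q (Functor.obj F p) (l p))
    (h : ∀ p, ∃ e : (⟨Functor.obj F p⟩ : Underlying Q) = ⟨l p⟩, θ p = eqToIso e) :
    conj F l θ = F := by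
  obtain rfl : Functor.obj F = l := funext fun p => congrArg Underlying.ob (h p).1
  obtain rfl : θ = fun p => Iso.refl _ := funext fun p => (h p).2
  exact functor_ext (fun _ => rfl) fun ψ => heq_of_eq (conjEquiv_refl _)

/-- A functor isomorphic to a fully faithful one is fully faithful. -/
theorem isFullyFaithful_conj {F : P ⟶ Q} (hF : IsFullyFaithful F) (l : P.Ob → Q.Ob)
    (θ : ∀ p, ObIso Q (Functor.obj F p) (l p)) : IsFullyFaithful (conj F l θ) :=
  fun n c p => (conjEquiv _ _).bijective.comp (hF n c p)

theorem conj_conj_symm (F : P ⟶ Q) (l : P.Ob → Q.Ob) (θ : ∀ p, ObIso Q (Functor.obj F p) (l p)) :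
    conj (conj F l θ) (Functor.obj F) (fun p => (θ p).symm) = F :=
  functor_ext (fun _ => rfl) fun _ => heq_of_eq ((conjEquiv _ _).symm_apply_apply _)

end Conj

end SymmOperad

namespace SymmOperad

/-! ### Operadic equivalences -/

variable {P Q R : SymmOperad.{u}}

/-- The isomorphism between two equal objects. -/
abbrev eqObIso {a b : P.Ob} (h : a = b) : ObIso P a b := eqToIso (congrArg Underlying.mk h)

theorem operadicEquivalences_iff {F : P ⟶ Q} :
    operadicEquivalences F ↔
      (∀ q, ∃ p, Nonempty (ObIso Q (Functor.obj F p) q)) ∧ IsFullyFaithful F := by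
  refine and_congr ⟨fun h q => ?_, fun h => ⟨fun q => ?_⟩⟩ Iff.rfl
  · obtain ⟨p, hp⟩ := h.mem_essImage ⟨q⟩
    exact ⟨p.ob, hp⟩
  · obtain ⟨p, hp⟩ := h q.ob
    exact ⟨⟨p⟩, hp⟩

theorem IsFullyFaithful.nonempty_obIso {F : P ⟶ Q} (hF : IsFullyFaithful F) {a b : P.Ob}
    (f : ObIso Q (Functor.obj F a) (Functor.obj F b)) :
    ∃ g : ObIso P a b, mapObIso F g = f := by
  have : (Functor.underlying F).Full := ⟨fun f => (hF 1 _ _).2 f⟩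
  have : (Functor.underlying F).Faithful := ⟨fun h => (hF 1 _ _).1 h⟩
  exact ⟨(Functor.underlying F).preimageIso f, Iso.ext ((Functor.underlying F).map_preimage f.hom)⟩

/-- If `F` is essentially surjective, every set of morphisms of `Q` is in bijection with one between
objects in the image of `F`, by conjugation with isomorphisms. -/
theorem IsFullyFaithful.of_comp_left {F : P ⟶ Q} {G : Q ⟶ R}
    (hF : operadicEquivalences F) (hFG : IsFullyFaithful (F ≫ G)) : IsFullyFaithful G := by
  obtain ⟨hs, hF⟩ := operadicEquivalences_iff.1 hF
  choose x θ using hs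
  intro n c p
  let e := conjEquiv (fun i => (θ (c i)).some.symm) (θ p).some.symm
  let e' := conjEquiv (fun i => mapObIso G (θ (c i)).some.symm) (mapObIso G (θ p).some.symm)
  have h1 : Function.Bijective (fun ψ : Q.Hom _ _ => Functor.map G ψ) :=
    (Function.Bijective.of_comp_iff _ (hF n (fun i => x (c i)) (x p))).1 (hFG n _ _)
  have h2 : (fun ψ => Functor.map G ψ) ∘ e = e' ∘ fun ψ => Functor.map G ψ :=
    funext fun ψ => map_conjEquiv G _ _ _
  exact (Function.Bijective.of_comp_iff' e'.bijective _).1 (h2 ▸ h1.comp e.bijective)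

theorem hasTwoOutOfThreeProperty_operadicEquivalences :
    operadicEquivalences.{u}.HasTwoOutOfThreeProperty where
  comp_mem F G hF hG := by
    obtain ⟨hs, hF⟩ := operadicEquivalences_iff.1 hF
    obtain ⟨hs', hG⟩ := operadicEquivalences_iff.1 hG
    refine operadicEquivalences_iff.2 ⟨fun r => ?_, hF.comp hG⟩
    obtain ⟨q, ⟨f⟩⟩ := hs' r
    obtain ⟨p, ⟨g⟩⟩ := hs q
    exact ⟨p, ⟨mapObIso G g ≪≫ f⟩⟩
  of_postcomp F G hG hFG := by
    obtain ⟨hs, hG⟩ := operadicEquivalences_iff.1 hG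
    obtain ⟨hs', hFG⟩ := operadicEquivalences_iff.1 hFG
    refine operadicEquivalences_iff.2 ⟨fun q => ?_, hFG.of_comp_right hG⟩
    obtain ⟨p, ⟨f⟩⟩ := hs' (Functor.obj G q)
    obtain ⟨g, -⟩ := hG.nonempty_obIso (a := Functor.obj F p) f
    exact ⟨p, ⟨g⟩⟩
  of_precomp F G hF hFG := by
    obtain ⟨hs', hFG'⟩ := operadicEquivalences_iff.1 hFG
    refine operadicEquivalences_iff.2 ⟨fun r => ?_, hFG'.of_comp_left hF⟩
    obtain ⟨p, hp⟩ := hs' r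
    exact ⟨Functor.obj F p, hp⟩

theorem exists_heq {n : ℕ} {c c' : Fin n → P.Ob} {p p' : P.Ob} (hc : ∀ i, c i = c' i) (hp : p = p')
    (ψ : P.Hom c p) : ∃ ψ' : P.Hom c' p', HEq ψ' ψ := by
  obtain rfl : c = c' := funext hc
  subst hp
  exact ⟨ψ, HEq.rfl⟩

theorem heq_map_of_eq_id {F : P ⟶ P} (h : F = 𝟙 P) {n : ℕ} {c : Fin n → P.Ob}
    {p : P.Ob} (ψ : P.Hom c p) : HEq (Functor.map F ψ) ψ :=
  heq_map_of_eq h ψ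

theorem isStableUnderRetracts_operadicEquivalences :
    operadicEquivalences.{u}.IsStableUnderRetracts where
  of_retract {P Q X Y f g} h hg := by
    obtain ⟨hs, hg⟩ := operadicEquivalences_iff.1 hg
    have hi := h.i_w
    have hr := h.r_w
    have hl := h.retract_left
    have hl' := h.retract_right
    refine operadicEquivalences_iff.2 ⟨fun q => ?_, fun n c p => ⟨fun ψ ψ' hψ => ?_, fun φ => ?_⟩⟩
    · obtain ⟨x, ⟨a⟩⟩ := hs (Functor.obj h.i.right q)
      exact ⟨Functor.obj h.r.left x, ⟨eqObIso (obj_of_eq hr x) ≪≫ mapObIso h.r.right a ≪≫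
        eqObIso (obj_of_eq hl' q)⟩⟩
    · have h1 : Functor.map (h.i.left ≫ g) ψ = Functor.map (h.i.left ≫ g) ψ' := by
        rw [hi]
        exact congrArg (Functor.map h.i.right) hψ
      have h2 : Functor.map h.i.left ψ = Functor.map h.i.left ψ' := (hg _ _ _).1 h1
      exact eq_of_heq ((heq_map_of_eq hl ψ).symm.trans
        ((heq_of_eq (congrArg (Functor.map h.r.left) h2)).trans (heq_map_of_eq hl ψ')))
    · have e := fun p => obj_of_eq hi p
      have e' := fun p => obj_of_eq hl p
      obtain ⟨φ', hφ'⟩ := exists_heq (fun i => (e (c i)).symm) (e p).symm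
        (Functor.map h.i.right φ)
      obtain ⟨χ, rfl⟩ := (hg _ _ _).2 φ'
      obtain ⟨ψ, hψ⟩ := exists_heq (fun i => e' (c i)) (e' p) (Functor.map h.r.left χ)
      refine ⟨ψ, eq_of_heq ?_⟩
      refine (heq_map f (fun i => (e' (c i)).symm) (e' p).symm hψ).trans ?_
      refine (heq_map_of_eq hr χ).trans ?_
      exact (heq_map h.r.right (fun i => e (c i)) (e p) hφ').trans (heq_map_of_eq hl' φ)

theorem isStableUnderRetracts_injectiveOnObjects :
    injectiveOnObjects.{u}.IsStableUnderRetracts where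
  of_retract {P Q X Y f g} h hg := fun a b hab => by
    have hi := h.i_w
    have h1 : Functor.obj (h.i.left ≫ g) a = Functor.obj (h.i.left ≫ g) b := by
      rw [hi]
      exact congrArg (Functor.obj h.i.right) hab
    have h2 : Functor.obj h.i.left a = Functor.obj h.i.left b := hg h1
    exact (obj_of_eq h.retract_left a).symm.trans
      ((congrArg (Functor.obj h.r.left) h2).trans (obj_of_eq h.retract_left b))

/-! ### Isofibrations -/

theorem isofibrations_iff {F : P ⟶ Q} : isofibrations F ↔
    ∀ (p : P.Ob) (q : Q.Ob) (ψ : ObIso Q (Functor.obj F p) q), ∃ (p' : P.Ob) (φ : ObIso P p p')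
      (h : Functor.obj F p' = q), mapObIso F φ ≪≫ eqObIso h = ψ :=
  ⟨fun H p q ψ => by
    obtain ⟨p', φ, h, hφ⟩ := H ⟨p⟩ ⟨q⟩ ψ
    exact ⟨p'.ob, φ, congrArg Underlying.ob h, hφ⟩,
  fun H p q ψ => by
    obtain ⟨p', φ, h, hφ⟩ := H p.ob q.ob ψ
    exact ⟨⟨p'⟩, φ, congrArg Underlying.mk h, hφ⟩⟩

theorem mapObIso_eqObIso (F : P ⟶ Q) {a b : P.Ob} (h : a = b) :
    mapObIso F (eqObIso h) = eqObIso (congrArg (Functor.obj F) h) := by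
  subst h
  exact CategoryTheory.Functor.mapIso_refl _ _

theorem mapObIso_of_eq {F G : P ⟶ Q} (h : F = G) {a b : P.Ob} (f : ObIso P a b) :
    mapObIso F f = eqObIso (obj_of_eq h a) ≪≫ mapObIso G f ≪≫ eqObIso (obj_of_eq h b).symm := by
  subst h
  exact Iso.ext (by simp)

theorem mapObIso_comp (F : P ⟶ Q) (G : Q ⟶ R) {a b : P.Ob} (f : ObIso P a b) :
    mapObIso (F ≫ G) f = mapObIso G (mapObIso F f) := rfl

theorem mapObIso_trans (F : P ⟶ Q) {a b c : P.Ob} (f : ObIso P a b) (g : ObIso P b c) :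
    mapObIso F (f ≪≫ g) = mapObIso F f ≪≫ mapObIso F g :=
  (Functor.underlying F).mapIso_trans f g

theorem isStableUnderRetracts_isofibrations :
    isofibrations.{u}.IsStableUnderRetracts where
  of_retract {P Q X Y f g} h hg := by
    rw [isofibrations_iff] at hg ⊢
    intro p q ψ
    have hi := fun p => obj_of_eq h.i_w p
    have hl := h.retract_left
    obtain ⟨x, φ, hx, hφ⟩ := hg (Functor.obj h.i.left p) (Functor.obj h.i.right q)
      (eqObIso (hi p) ≪≫ mapObIso h.i.right ψ)
    have hxq : Functor.obj f (Functor.obj h.r.left x) = q :=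
      (obj_of_eq h.r_w x).trans ((congrArg (Functor.obj h.r.right) hx).trans
        (obj_of_eq h.retract_right q))
    refine ⟨Functor.obj h.r.left x, eqObIso (obj_of_eq hl p).symm ≪≫ mapObIso h.r.left φ, hxq, ?_⟩
    have hφ' : mapObIso g φ = (eqObIso (hi p) ≪≫ mapObIso h.i.right ψ) ≪≫ eqObIso hx.symm := by
      rw [← hφ]
      exact Iso.ext (by simp)
    have h1 := mapObIso_of_eq h.r_w φ
    rw [mapObIso_comp, mapObIso_comp, hφ', mapObIso_trans, mapObIso_trans, mapObIso_eqObIso,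
      mapObIso_eqObIso, ← mapObIso_comp h.i.right, mapObIso_of_eq h.retract_right] at h1
    rw [mapObIso_trans, mapObIso_eqObIso, h1]
    change _ ≪≫ _ = mapObIso (𝟙 Q) ψ
    exact Iso.ext (by simp)

theorem isofibrations_of_surjective {F : P ⟶ Q} (hs : Function.Surjective (Functor.obj F))
    (hF : IsFullyFaithful F) : isofibrations F := by
  rw [isofibrations_iff]
  intro p q ψ
  obtain ⟨p', rfl⟩ := hs q
  obtain ⟨φ, rfl⟩ := hF.nonempty_obIso ψ
  exact ⟨p', φ, rfl, Iso.ext (by simp)⟩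

theorem operadicEquivalences_of_surjective {F : P ⟶ Q} (hs : Function.Surjective (Functor.obj F))
    (hF : IsFullyFaithful F) : operadicEquivalences F := by
  refine operadicEquivalences_iff.2 ⟨fun q => ?_, hF⟩
  obtain ⟨p, rfl⟩ := hs q
  exact ⟨p, ⟨Iso.refl _⟩⟩

theorem surjective_of_isofibrations {F : P ⟶ Q} (hF : isofibrations F)
    (hF' : operadicEquivalences F) : Function.Surjective (Functor.obj F) := by
  intro q
  obtain ⟨p, ⟨f⟩⟩ := (operadicEquivalences_iff.1 hF').1 q
  obtain ⟨p', -, h, -⟩ := isofibrations_iff.1 hF p q f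
  exact ⟨p', h⟩

/-! ### Lifting properties -/

/-- The lifting property of cofibrations against trivial fibrations.  Injectivity of `i` allows
prescribing the lift on the objects in its image. -/
theorem exists_lift_of_surjective {A B X Y : SymmOperad.{u}} {i : A ⟶ B} {p : X ⟶ Y}
    (hi : injectiveOnObjects i) (hs : Function.Surjective (Functor.obj p))
    (hp : IsFullyFaithful p) (f : A ⟶ X) (g : B ⟶ Y) (w : f ≫ p = i ≫ g) :
    ∃ L : B ⟶ X, i ≫ L = f ∧ L ≫ p = g := by
  have H : ∀ b, ∃ x, Functor.obj p x = Functor.obj g b ∧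
      ∀ a, Functor.obj i a = b → x = Functor.obj f a := by
    intro b
    by_cases hb : ∃ a, Functor.obj i a = b
    · obtain ⟨a, rfl⟩ := hb
      exact ⟨Functor.obj f a, obj_of_eq w a, fun a' ha' => by rw [hi ha']⟩
    · obtain ⟨x, hx⟩ := hs (Functor.obj g b)
      exact ⟨x, hx, fun a ha => (hb ⟨a, ha⟩).elim⟩
  choose l hl hl' using H
  obtain ⟨L, rfl, hL⟩ := hp.exists_lift g l hl
  refine ⟨L, functor_ext_of_faithful p (fun c q => (hp _ c q).1) (fun a => hl' _ a rfl) ?_, hL⟩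
  rw [Category.assoc, hL, w]

theorem conj_congr {F F' : P ⟶ Q} (h : F = F') {l l' : P.Ob → Q.Ob} (hl : ∀ p, l p = l' p)
    (θ : ∀ p, ObIso Q (Functor.obj F p) (l p)) (θ' : ∀ p, ObIso Q (Functor.obj F' p) (l' p))
    (hθ : ∀ p, θ p = eqObIso (obj_of_eq h p) ≪≫ θ' p ≪≫ eqObIso (hl p).symm) :
    conj F l θ = conj F' l' θ' := by
  subst h
  obtain rfl : l = l' := funext hl
  obtain rfl : θ = θ' := funext fun p => (hθ p).trans (Iso.ext (by simp))
  rfl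

/-- A trivial cofibration is the inclusion of a strong deformation retract. -/
theorem exists_retraction {A B : SymmOperad.{u}} {i : A ⟶ B} (hi : injectiveOnObjects i)
    (hi' : operadicEquivalences i) :
    ∃ (R : B ⟶ A) (θ : ∀ b, ObIso B (Functor.obj i (Functor.obj R b)) b), i ≫ R = 𝟙 A ∧
      conj (R ≫ i) (fun b => b) θ = 𝟙 B ∧
      ∀ a, ∃ e : Functor.obj i (Functor.obj R (Functor.obj i a)) = Functor.obj i a,
        θ (Functor.obj i a) = eqObIso e := by
  obtain ⟨hs, hi'⟩ := operadicEquivalences_iff.1 hi'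
  have H : ∀ b, ∃ (a : A.Ob) (β : ObIso B (Functor.obj i a) b), ∀ a', Functor.obj i a' = b →
      ∃ e : Functor.obj i a = b, β = eqObIso e := by
    intro b
    by_cases hb : ∃ a, Functor.obj i a = b
    · obtain ⟨a, rfl⟩ := hb
      exact ⟨a, Iso.refl _, fun _ _ => ⟨rfl, rfl⟩⟩
    · obtain ⟨a, ⟨β⟩⟩ := hs b
      exact ⟨a, β, fun a ha => (hb ⟨a, ha⟩).elim⟩
  choose r β hβ using H
  obtain ⟨R, rfl, hR⟩ := hi'.exists_lift
    (conj (𝟙 B) (fun b => Functor.obj i (r b)) (fun b => (β b).symm)) r (fun _ => rfl)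
  refine ⟨R, β, ?_, ?_, fun a => hβ _ a rfl⟩
  · refine functor_ext_of_faithful i (fun c q => (hi' _ c q).1)
      (fun a => hi (hβ _ a rfl).1) ?_
    rw [Category.assoc, hR, comp_conj, Category.id_comp]
    refine conj_eqToIso _ _ _ fun a => ?_
    obtain ⟨e, he⟩ := hβ (Functor.obj i a) a rfl
    exact ⟨congrArg Underlying.mk e.symm, by rw [he]; rfl⟩
  · refine (conj_congr hR (fun _ => rfl) β β fun b =>
      ((Iso.refl_trans _).trans (Iso.trans_refl _)).symm).trans ?_
    exact conj_conj_symm (𝟙 B) _ (fun b => (β b).symm)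

/-- The lifting property of trivial cofibrations against fibrations.  With `R` a retraction of `i`,
the lift is `R ≫ f`, conjugated with lifts along `p` of the isomorphisms from `i (R b)` to `b`;
over the image of `i` these lifts are taken to be identities. -/
theorem exists_lift_of_isofibrations {A B X Y : SymmOperad.{u}} {i : A ⟶ B} {p : X ⟶ Y}
    (hi : injectiveOnObjects i) (hi' : operadicEquivalences i) (hp : isofibrations p)
    (f : A ⟶ X) (g : B ⟶ Y) (w : f ≫ p = i ≫ g) :
    ∃ L : B ⟶ X, i ≫ L = f ∧ L ≫ p = g := by
  obtain ⟨R, β, hR, hβ, hβ'⟩ := exists_retraction hi hi'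
  rw [isofibrations_iff] at hp
  have hRf := fun a => congrArg (Functor.obj f) (obj_of_eq hR a)
  have H : ∀ b, ∃ (x : X.Ob) (φ : ObIso X (Functor.obj f (Functor.obj R b)) x)
      (hx : Functor.obj p x = Functor.obj g b),
      mapObIso p φ = eqObIso (obj_of_eq w _) ≪≫ mapObIso g (β b) ≪≫ eqObIso hx.symm ∧
      ∀ a, Functor.obj i a = b →
        ∃ e : (⟨Functor.obj f (Functor.obj R b)⟩ : Underlying X) = ⟨x⟩,
          φ = eqToIso e ∧ x = Functor.obj f a := by
    intro b
    by_cases hb : ∃ a, Functor.obj i a = b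
    · obtain ⟨a, rfl⟩ := hb
      refine ⟨Functor.obj f a, eqObIso (hRf a), obj_of_eq w a, ?_,
        fun a' ha' => ⟨congrArg Underlying.mk (hRf a), rfl, by rw [hi ha']⟩⟩
      obtain ⟨e, he⟩ := hβ' a
      rw [he, mapObIso_eqObIso, mapObIso_eqObIso]
      exact Iso.ext (by simp)
    · obtain ⟨x, φ, hx, hφ⟩ := hp _ _ (eqObIso (obj_of_eq w _) ≪≫ mapObIso g (β b))
      refine ⟨x, φ, hx, ?_, fun a ha => (hb ⟨a, ha⟩).elim⟩
      rw [← Iso.trans_assoc, ← hφ]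
      exact Iso.ext (by simp)
  choose x φ hx hφ hφ' using H
  refine ⟨conj (R ≫ f) x φ, ?_, ?_⟩
  · rw [comp_conj]
    refine (conj_eqToIso _ _ _ fun a => ?_).trans ?_
    · obtain ⟨e, he, -⟩ := hφ' _ a rfl
      exact ⟨e, he⟩
    · rw [← Category.assoc, hR, Category.id_comp]
  · rw [conj_comp, ← Category.id_comp g, ← hβ, conj_comp]
    have w' : (R ≫ f) ≫ p = (R ≫ i) ≫ g := by rw [Category.assoc, w, Category.assoc]
    exact conj_congr w' hx _ _ hφ

/-! ### Factorizations -/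

/-- A functor factors as a cofibration and a trivial fibration, through the operad whose objects are
those of `P` and those of `Q` and whose morphisms are those of `Q`. -/
theorem exists_factorization (F : P ⟶ Q) : ∃ (E : SymmOperad.{u}) (i : P ⟶ E) (p : E ⟶ Q),
    i ≫ p = F ∧ injectiveOnObjects i ∧ isofibrations p ∧ operadicEquivalences p := by
  let i : P ⟶ pull Q (Sum.elim (Functor.obj F) (fun q : Q.Ob => q)) :=
    { obj := Sum.inl
      map := fun ψ => Functor.map F ψ
      map_id := fun p => Functor.map_id F p
      map_comp := fun ψ χ => Functor.map_comp F ψ χ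
      map_act := fun σ h ψ => Functor.map_act F σ h ψ }
  have hs : Function.Surjective (Functor.obj
      (pullMap Q (Sum.elim (Functor.obj F) (fun q : Q.Ob => q)))) := fun q => ⟨Sum.inr q, rfl⟩
  exact ⟨_, i, pullMap Q _, rfl, fun _ _ h => Sum.inl.inj h,
    isofibrations_of_surjective hs (isFullyFaithful_pullMap _ _),
    operadicEquivalences_of_surjective hs (isFullyFaithful_pullMap _ _)⟩

/-- A functor factors as a trivial cofibration and a fibration, through its mapping path operad: the
objects are triples of an object `p` of `P`, an object `q` of `Q` and an isomorphism `F p ≅ q`, and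
the morphisms are those of `P` between the first components. -/
theorem exists_factorization_path (F : P ⟶ Q) :
    ∃ (E : SymmOperad.{u}) (i : P ⟶ E) (p : E ⟶ Q),
      i ≫ p = F ∧ injectiveOnObjects i ∧ operadicEquivalences i ∧ isofibrations p := by
  let S := Σ (p : P.Ob) (q : Q.Ob), ObIso Q (Functor.obj F p) q
  let π : pull P (fun s : S => s.1) ⟶ P := pullMap P _
  let i : P ⟶ pull P (fun s : S => s.1) :=
    { obj := fun p => ⟨p, Functor.obj F p, Iso.refl _⟩
      map := fun ψ => ψ
      map_id := fun _ => rfl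
      map_comp := fun _ _ => rfl
      map_act := fun _ _ _ => rfl }
  have hπ : IsFullyFaithful π := isFullyFaithful_pullMap _ _
  refine ⟨_, i, conj (π ≫ F) (fun s => s.2.1) (fun s => s.2.2), ?_, fun a b h => congrArg
    (fun s : S => s.1) h, operadicEquivalences_iff.2 ⟨fun s => ⟨s.1, ?_⟩,
    fun _ _ _ => Function.bijective_id⟩, isofibrations_iff.2 fun s q ψ => ?_⟩
  · exact conj_eqToIso F (Functor.obj F) (fun p => Iso.refl _) fun p => ⟨rfl, rfl⟩
  · obtain ⟨g, -⟩ := hπ.nonempty_obIso (a := Functor.obj i s.1) (b := s) (Iso.refl _)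
    exact ⟨g⟩
  · obtain ⟨g, hg⟩ := hπ.nonempty_obIso (a := s) (b := (⟨s.1, q, s.2.2 ≪≫ ψ⟩ : S)) (Iso.refl _)
    refine ⟨_, g, rfl, Iso.ext ?_⟩
    refine (Category.comp_id _).trans ?_
    have hg' : Functor.map F (Functor.map π g.hom) = Q.id (Functor.obj F s.1) :=
      (congrArg (Functor.map F) (congrArg Iso.hom hg)).trans (Functor.map_id F s.1)
    refine (congrArg (conjEquiv (fun _ => s.2.2) (s.2.2 ≪≫ ψ)) hg').trans ?_
    refine (conjEquiv_unary_id _ _).trans ?_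
    exact s.2.2.inv_hom_id_assoc ψ.hom

end SymmOperad

namespace SymmOperad

/-! ### Limits -/

section Limits

variable {J : Type u} [Category.{u} J] (D : J ⥤ SymmOperad.{u})

/-- The limit of a diagram of operads: objects and morphisms are the compatible families. -/
def limitOperad : SymmOperad.{u} where
  Ob := {x : ∀ j, (D.obj j).Ob // ∀ ⦃j j' : J⦄ (f : j ⟶ j'), Functor.obj (D.map f) (x j) = x j'}
  Hom c p := {ψ : ∀ j, (D.obj j).Hom (fun i => (c i).1 j) (p.1 j) //
    ∀ ⦃j j' : J⦄ (f : j ⟶ j'), HEq (Functor.map (D.map f) (ψ j)) (ψ j')}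
  id p := ⟨fun j => (D.obj j).id (p.1 j), fun j j' f =>
    (heq_of_eq (Functor.map_id (D.map f) (p.1 j))).trans (by rw [p.2 f])⟩
  comp {n k c d p} ψ χ := ⟨fun j => (D.obj j).comp (ψ.1 j) (fun i => (χ i).1 j), fun j j' f =>
    (heq_of_eq (Functor.map_comp (D.map f) _ _)).trans <|
      heq_comp _ (fun i => (c i).2 f) (fun i r => (d i r).2 f) (p.2 f) (ψ.2 f) (fun i => (χ i).2 f)⟩
  act {n m c d p} σ h ψ := ⟨fun j =>
      (D.obj j).act σ (fun i => congrArg (fun x => x.1 j) (h i)) (ψ.1 j),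
    fun j j' f => (heq_of_eq (Functor.map_act (D.map f) _ _ _)).trans <|
      heq_act _ σ (fun i => (c i).2 f) (p.2 f) (ψ.2 f)⟩
  act_refl ψ := Subtype.ext (funext fun j => (D.obj j).act_refl _)
  act_act σ τ _ _ ψ := Subtype.ext (funext fun j => (D.obj j).act_act _ _ _ _ _)
  id_comp ψ := Subtype.ext (funext fun j => (D.obj j).id_comp _)
  comp_id ψ := Subtype.ext (funext fun j => (D.obj j).comp_id _)
  assoc ψ χ ω := Subtype.ext (funext fun j => (D.obj j).assoc (ψ.1 j) (fun i => (χ i).1 j)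
    (fun i r => (ω i r).1 j))
  act_comp σ ψ χ := Subtype.ext (funext fun j => (D.obj j).act_comp σ (ψ.1 j) (fun i => (χ i).1 j))
  comp_act τ ψ χ := Subtype.ext (funext fun j => (D.obj j).comp_act τ (ψ.1 j) (fun i => (χ i).1 j))

/-- The projections of `limitOperad D`. -/
def limitProj (j : J) : limitOperad D ⟶ D.obj j :=
  { obj := fun x => x.1 j
    map := fun ψ => ψ.1 j
    map_id := fun _ => rfl
    map_comp := fun _ _ => rfl
    map_act := fun _ _ _ => rfl }

/-- The limiting cone. -/
def limitOperadCone : Cone D where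
  pt := limitOperad D
  π :=
    { app := limitProj D
      naturality := fun _ _ f => functor_ext (fun x => (x.2 f).symm) (fun ψ => (ψ.2 f).symm) }

/-- The functor to the limit given by a cone. -/
def limitLift (s : Cone D) : s.pt ⟶ limitOperad D :=
  { obj := fun p => ⟨fun j => Functor.obj (s.π.app j) p, fun _ _ f => obj_of_eq (s.w f) p⟩
    map := fun ψ => ⟨fun j => Functor.map (s.π.app j) ψ, fun _ _ f => heq_map_of_eq (s.w f) ψ⟩
    map_id := fun _ => Subtype.ext (funext fun _ => Functor.map_id _ _)
    map_comp := fun ψ χ => Subtype.ext (funext fun j => Functor.map_comp (s.π.app j) ψ χ)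
    map_act := fun σ h ψ => Subtype.ext (funext fun j => Functor.map_act (s.π.app j) σ h ψ) }

theorem heq_limitHom {n : ℕ} {c c' : Fin n → (limitOperad D).Ob} {p p' : (limitOperad D).Ob}
    (hc : ∀ i, c i = c' i) (hp : p = p') (ψ : (limitOperad D).Hom c p)
    (ψ' : (limitOperad D).Hom c' p') (h : ∀ j, HEq (ψ.1 j) (ψ'.1 j)) : HEq ψ ψ' := by
  obtain rfl : c = c' := funext hc
  subst hp
  exact heq_of_eq (Subtype.ext (funext fun j => eq_of_heq (h j)))

/-- The cone of `limitOperad D` is limiting. -/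
def isLimitLimitOperadCone : IsLimit (limitOperadCone D) where
  lift := limitLift D
  fac s j := rfl
  uniq s m hm := by
    have ho : ∀ p, Functor.obj m p = Functor.obj (limitLift D s) p := fun p =>
      Subtype.ext (funext fun j => obj_of_eq (hm j) p)
    exact functor_ext ho fun ψ => heq_limitHom D (fun _ => ho _) (ho _) _ _
      fun j => heq_map_of_eq (hm j) ψ

instance : HasLimits SymmOperad.{u} where
  has_limits_of_shape _ _ := ⟨fun D => ⟨⟨_, isLimitLimitOperadCone D⟩⟩⟩

end Limits

/-! ### Functors out of a presented operad -/

section Presentation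

variable {X : Type u} {Gen : ∀ ⦃n : ℕ⦄, (Fin n → X) → X → Type u}
variable {rel : ∀ ⦃n : ℕ⦄ ⦃c : Fin n → X⦄ ⦃p : X⦄, Term Gen c p → Term Gen c p → Prop}

theorem presented_comp_mk {n : ℕ} {k : Fin n → ℕ} {c : Fin n → X} {d : ∀ i, Fin (k i) → X}
    {p : X} (t : Term Gen c p) (s : ∀ i, Term Gen (d i) (c i)) :
    (presented rel).comp (Quotient.mk (relSetoid rel _ _) t)
      (fun i => Quotient.mk (relSetoid rel _ _) (s i)) =
    Quotient.mk (relSetoid rel _ _) (Term.comp t s) :=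
  PHom.comp_mk rel t s

/-- Functors out of a presented operad are determined by their values on the generators. -/
theorem presented_hom_ext {R : SymmOperad.{u}} {F G : presented rel ⟶ R}
    (ho : ∀ x : X, Functor.obj F x = Functor.obj G x)
    (hm : ∀ {n : ℕ} {c : Fin n → X} {p : X} (a : Gen c p),
      HEq (Functor.map F (ofGen rel a)) (Functor.map G (ofGen rel a))) : F = G := by
  obtain ⟨fo, fm, fid, fcomp, fact⟩ := F
  obtain ⟨go, gm, gid, gcomp, gact⟩ := G
  obtain rfl : fo = go := funext ho
  refine functor_ext (fun _ => rfl) fun {n c p} ψ => heq_of_eq ?_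
  obtain ⟨t, rfl⟩ := Quotient.exists_rep ψ
  dsimp only
  induction t with
  | gen a => exact eq_of_heq (hm a)
  | id p => exact (fid p).trans (gid p).symm
  | comp t s iht ihs =>
    have h := presented_comp_mk (rel := rel) t s
    exact (congrArg _ h.symm).trans ((fcomp _ _).trans
      ((congrArg₂ R.comp iht (funext ihs)).trans ((gcomp _ _).symm.trans (congrArg _ h))))
  | act σ h t ih => exact (fact σ h _).trans ((congrArg _ ih).trans (gact σ h _).symm)

theorem Term.heq_eval {R : SymmOperad.{u}} (f : X → R.Ob)
    (g : ∀ ⦃n : ℕ⦄ ⦃c : Fin n → X⦄ ⦃p : X⦄, Gen c p → R.Hom (fun i => f (c i)) (f p))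
    {n : ℕ} {c c' : Fin n → X} {p p' : X} (hc : ∀ i, c i = c' i) (hp : p = p') {t : Term Gen c p}
    {t' : Term Gen c' p'} (h : HEq t t') : HEq (Term.eval f g t) (Term.eval f g t') := by
  obtain rfl : c = c' := funext hc
  subst hp
  obtain rfl := eq_of_heq h
  rfl

theorem heq_mk {n : ℕ} {c c' : Fin n → X} {p p' : X} (hc : ∀ i, c i = c' i) (hp : p = p')
    {t : Term Gen c p} {t' : Term Gen c' p'} (h : HEq t t') :
    HEq (Quotient.mk (relSetoid rel _ _) t) (Quotient.mk (relSetoid rel _ _) t') := by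
  obtain rfl : c = c' := funext hc
  subst hp
  obtain rfl := eq_of_heq h
  rfl

theorem Term.exists_heq {n : ℕ} {c c' : Fin n → X} {p p' : X} (hc : ∀ i, c i = c' i) (hp : p = p')
    (t : Term Gen c p) : ∃ t' : Term Gen c' p', HEq t' t := by
  obtain rfl : c = c' := funext hc
  subst hp
  exact ⟨t, HEq.rfl⟩

end Presentation

/-! ### Colimits -/

section Colimits

variable {J : Type u} [Category.{u} J] (D : J ⥤ SymmOperad.{u})

/-- The objects of the colimit of a diagram of operads. -/
def ColimOb : Type u :=
  Quot (fun a b : Σ j, (D.obj j).Ob => ∃ f : a.1 ⟶ b.1, b.2 = Functor.obj (D.map f) a.2)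

variable {D} in
/-- The object of the colimit which is given by an object of one of the operads. -/
def ColimOb.mk {j : J} (p : (D.obj j).Ob) : ColimOb D := Quot.mk _ ⟨j, p⟩

variable {D} in
theorem ColimOb.mk_map {j j' : J} (f : j ⟶ j') (p : (D.obj j).Ob) :
    (ColimOb.mk p : ColimOb D) = ColimOb.mk (Functor.obj (D.map f) p) :=
  Quot.sound ⟨f, rfl⟩

/-- The generators of the colimit: all morphisms of the operads in the diagram. -/
inductive ColimGen : ∀ ⦃n : ℕ⦄, (Fin n → ColimOb D) → ColimOb D → Type u
  | mk {j : J} {n : ℕ} {c : Fin n → (D.obj j).Ob} {p : (D.obj j).Ob} (ψ : (D.obj j).Hom c p) :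
      ColimGen (fun i => ColimOb.mk (c i)) (ColimOb.mk p)

/-- The relations of the colimit: functoriality for each operad in the diagram, and the
identification of a morphism with its images in the diagram.  The two sides of the latter have
domains and targets which are equal only propositionally. -/
inductive ColimRel : ∀ ⦃n : ℕ⦄ ⦃c : Fin n → ColimOb D⦄ ⦃p : ColimOb D⦄,
    Term (ColimGen D) c p → Term (ColimGen D) c p → Prop
  | id {j : J} (p : (D.obj j).Ob) :
      ColimRel (Term.gen (ColimGen.mk ((D.obj j).id p))) (Term.id (ColimOb.mk p))
  | comp {j : J} {n : ℕ} {k : Fin n → ℕ} {c : Fin n → (D.obj j).Ob}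
      {d : ∀ i, Fin (k i) → (D.obj j).Ob} {p : (D.obj j).Ob} (ψ : (D.obj j).Hom c p)
      (χ : ∀ i, (D.obj j).Hom (d i) (c i)) :
      ColimRel (Term.comp (Term.gen (ColimGen.mk ψ)) (fun i => Term.gen (ColimGen.mk (χ i))))
        (Term.gen (ColimGen.mk ((D.obj j).comp ψ χ)))
  | act {j : J} {n m : ℕ} {c : Fin m → (D.obj j).Ob} {d : Fin n → (D.obj j).Ob} {p : (D.obj j).Ob}
      (σ : Fin n ≃ Fin m) (h : ∀ i, d i = c (σ i)) (ψ : (D.obj j).Hom c p) :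
      ColimRel (Term.act σ (fun i => congrArg ColimOb.mk (h i)) (Term.gen (ColimGen.mk ψ)))
        (Term.gen (ColimGen.mk ((D.obj j).act σ h ψ)))
  | map {j j' : J} (f : j ⟶ j') {n : ℕ} {c : Fin n → (D.obj j).Ob} {p : (D.obj j).Ob}
      (ψ : (D.obj j).Hom c p) (t : Term (ColimGen D) (fun i => ColimOb.mk (c i)) (ColimOb.mk p))
      (h : HEq t (Term.gen (ColimGen.mk (Functor.map (D.map f) ψ)))) :
      ColimRel (Term.gen (ColimGen.mk ψ)) t

/-- The functors from the operads in the diagram to the colimit. -/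
def colimIncl (j : J) : D.obj j ⟶ presented (ColimRel D) :=
  { obj := fun p => ColimOb.mk p
    map := fun ψ => ofGen (ColimRel D) (ColimGen.mk ψ)
    map_id := fun p => Quotient.sound (Rel.of (ColimRel.id p))
    map_comp := fun ψ χ => ((presented_comp_mk _ _).trans
      (Quotient.sound (Rel.of (ColimRel.comp ψ χ)))).symm
    map_act := fun σ h ψ => (Quotient.sound (Rel.of (ColimRel.act σ h ψ))).symm }

/-- The colimiting cocone. -/
noncomputable def colimCocone : Cocone D where
  pt := presented (ColimRel D)
  ι :=
    { app := colimIncl D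
      naturality := fun j j' f => functor_ext (fun p => (ColimOb.mk_map f p).symm)
        (fun {n c p} ψ => by
          obtain ⟨t, ht⟩ := Term.exists_heq (fun i => (ColimOb.mk_map f (c i)).symm)
            (ColimOb.mk_map f p).symm (Term.gen (ColimGen.mk (Functor.map (D.map f) ψ)))
          refine (heq_mk (fun i => ColimOb.mk_map f (c i)) (ColimOb.mk_map f p) ht).symm.trans ?_
          exact heq_of_eq (Quotient.sound (Rel.of (ColimRel.map f ψ t ht))).symm) }

variable (s : Cocone D)

/-- The function on objects out of the colimit that is given by a cocone. -/
def colimDescObj : ColimOb D → s.pt.Ob :=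
  Quot.lift (fun a => Functor.obj (s.ι.app a.1) a.2) (by
    rintro ⟨j, p⟩ ⟨j', p'⟩ ⟨f, h⟩
    exact (obj_of_eq (s.w f) p).symm.trans (congrArg (Functor.obj (s.ι.app j')) h.symm))

/-- The values of the generators under the functor out of the colimit that is given by a cocone. -/
def colimDescGen : ∀ ⦃n : ℕ⦄ ⦃c : Fin n → ColimOb D⦄ ⦃p : ColimOb D⦄, ColimGen D c p →
    s.pt.Hom (fun i => colimDescObj D s (c i)) (colimDescObj D s p)
  | _, _, _, .mk (j := j) ψ => Functor.map (s.ι.app j) ψ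

/-- The functor out of the colimit that is given by a cocone. -/
noncomputable def colimDesc : presented (ColimRel D) ⟶ s.pt :=
  presentedLift (ColimRel D) (colimDescObj D s) (colimDescGen D s) (by
    intro n c p t t' h
    cases h with
    | id p => exact Functor.map_id _ _
    | comp ψ χ => exact (Functor.map_comp _ ψ χ).symm
    | act σ h ψ => exact (Functor.map_act _ σ h ψ).symm
    | map f ψ t h =>
      refine eq_of_heq (HEq.trans ?_ (Term.heq_eval _ _ (fun i => ColimOb.mk_map f _)
        (ColimOb.mk_map f _) h).symm)
      exact (heq_map_of_eq (s.w f) ψ).symm)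

/-- The cocone of the colimit is colimiting. -/
noncomputable def isColimitColimCocone : IsColimit (colimCocone D) where
  desc := colimDesc D
  fac s j := rfl
  uniq s m hm := by
    refine presented_hom_ext ?_ ?_
    · rintro ⟨j, p⟩
      exact obj_of_eq (hm j) p
    · rintro n c p ⟨ψ⟩
      exact heq_map_of_eq (hm _) ψ

instance : HasColimits SymmOperad.{u} where
  has_colimits_of_shape _ _ := ⟨fun D => ⟨⟨_, isColimitColimCocone D⟩⟩⟩

end Colimits

/-! ### The model structure -/

/-- The model structure whose weak equivalences are the operadic equivalences, whose cofibrations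
are the functors that are injective on objects and whose fibrations are the isofibrations. -/
@[reducible]
def modelCategory : ModelCategory SymmOperad.{u} where
  categoryWithFibrations := ⟨isofibrations⟩
  categoryWithCofibrations := ⟨injectiveOnObjects⟩
  categoryWithWeakEquivalences := ⟨operadicEquivalences⟩
  cm2 := hasTwoOutOfThreeProperty_operadicEquivalences
  cm3a := isStableUnderRetracts_operadicEquivalences
  cm3b := isStableUnderRetracts_isofibrations
  cm3c := isStableUnderRetracts_injectiveOnObjects
  cm4a i p hi hi' hp := ⟨fun {f g} sq => by
    obtain ⟨L, h1, h2⟩ := exists_lift_of_isofibrations hi.mem hi'.mem hp.mem f g sq.w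
    exact ⟨⟨⟨L, h1, h2⟩⟩⟩⟩
  cm4b i p hi hp hp' := ⟨fun {f g} sq => by
    obtain ⟨L, h1, h2⟩ := exists_lift_of_surjective hi.mem
      (surjective_of_isofibrations hp.mem hp'.mem) (operadicEquivalences_iff.1 hp'.mem).2 f g sq.w
    exact ⟨⟨⟨L, h1, h2⟩⟩⟩⟩
  cm5a := ⟨fun F => by
    obtain ⟨E, i, p, h, hi, hi', hp⟩ := exists_factorization_path F
    exact ⟨⟨E, i, p, h, ⟨hi, hi'⟩, hp⟩⟩⟩
  cm5b := ⟨fun F => by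
    obtain ⟨E, i, p, h, hi, hp, hp'⟩ := exists_factorization F
    exact ⟨⟨E, i, p, h, hi, ⟨hp, hp'⟩⟩⟩⟩

end SymmOperad

/-! ### Transformations of several functors -/

namespace FinBlock

theorem symm_swapEquiv {n m : ℕ} (x : Fin (∑ _i : Fin n, m)) :
    finSigmaFinEquiv.symm (swapEquiv n m x) =
      ⟨(finSigmaFinEquiv.symm x).2, (finSigmaFinEquiv.symm x).1⟩ :=
  Equiv.symm_apply_apply _ _

end FinBlock

namespace SymmOperad

/-- The compatibility of composition with a permutation of the outer morphism.  The lengths of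
the inner domains may agree only propositionally, so the resulting block permutation is described
by its effect on labels. -/
theorem exists_comp_act_left (P : SymmOperad.{u}) {n m : ℕ} {k : Fin m → ℕ} {k' : Fin n → ℕ}
    {c : Fin m → P.Ob} {c' : Fin n → P.Ob} {d : ∀ j, Fin (k j) → P.Ob}
    {d' : ∀ i, Fin (k' i) → P.Ob} {p : P.Ob} (σ : Fin n ≃ Fin m)
    (h : ∀ i, c' i = c (σ i)) (ψ : P.Hom c p) (χ : ∀ j, P.Hom (d j) (c j))
    (χ' : ∀ i, P.Hom (d' i) (c' i)) (hk : ∀ i, k' i = k (σ i)) (hd : ∀ i, HEq (d' i) (d (σ i)))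
    (hχ : ∀ i, HEq (χ' i) (χ (σ i))) :
    ∃ (τ : Fin (∑ i, k' i) ≃ Fin (∑ j, k j)) (hτ : ∀ x, concat d' x = concat d (τ x)),
      P.comp (P.act σ h ψ) χ' = P.act τ hτ (P.comp ψ χ) ∧
      ∀ {L : Type} (e : ∀ j, Fin (k j) → L) (e' : ∀ i, Fin (k' i) → L),
        (∀ i, HEq (e' i) (e (σ i))) → ∀ x, concat e' x = concat e (τ x) := by
  obtain rfl : k' = fun i => k (σ i) := funext hk
  obtain rfl : d' = fun i => d (σ i) := funext fun i => eq_of_heq (hd i)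
  refine ⟨outerEquiv σ k, concat_outerEquiv σ d, P.comp_act_left σ h ψ χ χ' hχ, ?_⟩
  intro L e e' he
  obtain rfl : e' = fun i => e (σ i) := funext fun i => eq_of_heq (he i)
  exact concat_outerEquiv σ e

theorem eq_act_of_act_eq (P : SymmOperad.{u}) {n m r : ℕ} {c : Fin m → P.Ob} {c' : Fin r → P.Ob}
    {d : Fin n → P.Ob} {p : P.Ob} {σ : Fin n ≃ Fin m} {τ : Fin n ≃ Fin r} {hσ : ∀ i, d i = c (σ i)}
    {hτ : ∀ i, d i = c' (τ i)} {ψ : P.Hom c p} {χ : P.Hom c' p} (h : P.act σ hσ ψ = P.act τ hτ χ) :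
    ψ = P.act (σ.symm.trans τ)
      (fun i => by rw [Equiv.trans_apply, ← hτ, hσ, Equiv.apply_symm_apply]) χ := by
  have h' : ∀ i, c i = d (σ.symm i) := fun i => by rw [hσ, Equiv.apply_symm_apply]
  rw [← P.act_symm_act σ hσ h' ψ, h, P.act_act]

section Natural

variable {S T : SymmOperad.{u}} {m : ℕ} (A : Fin m → (S ⟶ T)) (A₀ : S ⟶ T)
  (β : ∀ x, T.Hom (fun j => Functor.obj (A j) x) (Functor.obj A₀ x))

/-- The naturality at `ψ` of a family of morphisms `β x` from `A 0 x, ..., A (m-1) x` to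
`A₀ x`. -/
def IsNaturalAt {n : ℕ} {c : Fin n → S.Ob} {p : S.Ob} (ψ : S.Hom c p) : Prop :=
  T.comp (Functor.map A₀ ψ) (fun i => β (c i)) =
    T.act (swapEquiv n m) (concat_swapEquiv fun i j => Functor.obj (A j) (c i))
      (T.comp (β p) (fun j => Functor.map (A j) ψ))

variable {A A₀ β}

theorem isNaturalAt_id (x : S.Ob) : IsNaturalAt A A₀ β (S.id x) := by
  have h1 : T.comp (Functor.map A₀ (S.id x)) (fun _ => β x) =
      T.act (oneBlockEquiv m) (concat_oneBlockEquiv _) (β x) := by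
    rw [Functor.map_id]
    exact T.id_comp (β x)
  have h2 : T.comp (β x) (fun j => Functor.map (A j) (S.id x)) =
      T.act (onesEquiv m) (concat_onesEquiv _) (β x) := by
    simp only [Functor.map_id]
    exact T.comp_id (β x)
  refine h1.trans (Eq.trans ?_ ((congrArg (T.act _ _) h2).trans (T.act_act _ _ _ _ _)).symm)
  exact T.act_congr (equiv_eq_of_label (c := fun j => j) (fun _ _ h => h) (concat_oneBlockEquiv _)
    (concat_swapEquiv fun _ j => j)) _ _ _

theorem IsNaturalAt.act {n n' : ℕ} {c : Fin n → S.Ob} {d : Fin n' → S.Ob} {p : S.Ob}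
    {ψ : S.Hom c p} (hψ : IsNaturalAt A A₀ β ψ) (σ : Fin n' ≃ Fin n) (h : ∀ i, d i = c (σ i)) :
    IsNaturalAt A A₀ β (S.act σ h ψ) := by
  obtain rfl : d = fun i => c (σ i) := funext h
  have h1 : T.comp (Functor.map A₀ (S.act σ h ψ)) (fun i => β (c (σ i))) = _ :=
    (congrArg (fun a => T.comp a _) (Functor.map_act A₀ σ h ψ)).trans
      ((T.comp_act_left σ _ (Functor.map A₀ ψ) (fun i => β (c i)) _ fun _ => HEq.rfl).trans
        ((congrArg (T.act _ _) hψ).trans (T.act_act _ _ _ _ _)))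
  have h2 : T.comp (β p) (fun j => Functor.map (A j) (S.act σ h ψ)) = _ :=
    (congrArg (T.comp (β p)) (funext fun j => Functor.map_act (A j) σ h ψ)).trans
      (T.comp_act_right (fun _ => σ) _ (β p) (fun j => Functor.map (A j) ψ))
  refine h1.trans (Eq.trans ?_ ((congrArg (T.act _ _) h2).trans (T.act_act _ _ _ _ _)).symm)
  refine T.act_congr (equiv_eq_of_label (c := concat fun (j : Fin m) (i : Fin n) => (j, i))
    (concat_injective ?_) (d := concat fun (i : Fin n') (j : Fin m) => (j, σ i))
    (fun x => ?_) fun x => ?_) _ _ _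
  · rintro ⟨j, i⟩ ⟨j', i'⟩ h
    cases h
    rfl
  · exact (concat_outerEquiv σ (fun i j => (j, i)) x).trans (concat_swapEquiv (fun i j => (j, i)) _)
  · exact (concat_swapEquiv (fun i j => (j, σ i)) x).trans
      (concat_innerEquiv (fun _ => σ) (fun j i => (j, i)) _)

/-- Naturality passes to composites. -/
theorem IsNaturalAt.comp {n : ℕ} {k : Fin n → ℕ} {c : Fin n → S.Ob} {d : ∀ i, Fin (k i) → S.Ob}
    {p : S.Ob} {ψ : S.Hom c p} {χ : ∀ i, S.Hom (d i) (c i)} (hψ : IsNaturalAt A A₀ β ψ)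
    (hχ : ∀ i, IsNaturalAt A A₀ β (χ i)) : IsNaturalAt A A₀ β (S.comp ψ χ) := by
  -- Naturality at each `χ i` turns the left-hand side into a permutation of the composite of
  -- `A₀ ψ`, the `β (c i)` and the `A r (χ i)`; naturality at `ψ` turns this into a permutation of
  -- the right-hand side.  That the permutations agree is checked on the labels `(r, i, j)`.
  have h1 : T.comp (Functor.map A₀ (S.comp ψ χ)) (fun x => β (concat d x)) = _ :=
    (congrArg (fun a => T.comp a _) (Functor.map_comp A₀ ψ χ)).trans
      ((T.assoc (Functor.map A₀ ψ) (fun i => Functor.map A₀ (χ i)) (fun i j => β (d i j))).trans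
        ((congrArg (T.act _ _) ((congrArg (T.comp (Functor.map A₀ ψ)) (funext hχ)).trans
          (T.comp_act_right _ _ _ _))).trans (T.act_act _ _ _ _ _)))
  have h2 := T.assoc (Functor.map A₀ ψ) (fun i => β (c i)) (fun i r => Functor.map (A r) (χ i))
  obtain ⟨τ, hτ, h3, hτ'⟩ := T.exists_comp_act_left (swapEquiv n m)
    (concat_swapEquiv fun i j => Functor.obj (A j) (c i))
    (T.comp (β p) (fun j => Functor.map (A j) ψ))
    (fun y => Functor.map (A (finSigmaFinEquiv.symm y).1) (χ (finSigmaFinEquiv.symm y).2))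
    (fun x => Functor.map (A (finSigmaFinEquiv.symm x).2) (χ (finSigmaFinEquiv.symm x).1))
    (fun x => by rw [symm_swapEquiv])
    (fun x => congr_arg_heq (fun (z : Σ _ : Fin m, Fin n) (y : Fin (k z.2)) =>
      Functor.obj (A z.1) (d z.2 y)) (symm_swapEquiv x).symm)
    (fun x => congr_arg_heq (fun z : Σ _ : Fin m, Fin n => Functor.map (A z.1) (χ z.2))
      (symm_swapEquiv x).symm)
  have h4 := T.assoc (β p) (fun j => Functor.map (A j) ψ) (fun r i => Functor.map (A r) (χ i))
  have h5 := h2.symm.trans ((congrArg (fun a => T.comp a _) hψ).trans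
    (h3.trans ((congrArg (T.act _ _) h4).trans (T.act_act _ _ _ _ _))))
  have h6 := h1.trans ((congrArg (T.act _ _) (T.eq_act_of_act_eq h5)).trans (T.act_act _ _ _ _ _))
  refine h6.trans (Eq.trans ?_ (congrArg (fun a => T.act _ _ (T.comp (β p) a))
    (funext fun j => Functor.map_comp (A j) ψ χ)).symm)
  refine T.act_congr (equiv_eq_of_label
    (c := concat fun (r : Fin m) => concat fun i (j : Fin (k i)) => (r, FinBlock.label k i j))
    ?_ (d := concat fun x (r : Fin m) => (r, concat (FinBlock.label k) x))
    (fun x => ?_) fun x => ?_) _ _ _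
  · refine concat_injective ?_
    rintro ⟨r, x⟩ ⟨r', x'⟩ h
    obtain ⟨rfl, h'⟩ := Prod.mk.inj h
    obtain rfl : x = x' := label_injective k h'
    rfl
  · have s1 := concat_assoc (fun i j (r : Fin m) => (r, FinBlock.label k i j)) x
    have s2 := concat_innerEquiv_of_eq (fun i => swapEquiv (k i) m)
      (fun i => concat_swapEquiv fun j (r : Fin m) => (r, FinBlock.label k i j))
      (assocEquiv k (fun _ _ => m) x)
    have s3 := fun y => concat_assoc (fun i (r : Fin m) j => (r, FinBlock.label k i j))
      ((assocEquiv (fun _ => m) fun i _ => k i).symm y)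
    simp only [Equiv.apply_symm_apply] at s3
    have s4 := hτ' (fun y j => ((finSigmaFinEquiv.symm y).1,
        FinBlock.label k (finSigmaFinEquiv.symm y).2 j))
      (fun x j => ((finSigmaFinEquiv.symm x).2, FinBlock.label k (finSigmaFinEquiv.symm x).1 j))
      (fun x => congr_arg_heq (fun (z : Σ _ : Fin m, Fin n) (y : Fin (k z.2)) =>
        (z.1, FinBlock.label k z.2 y)) (symm_swapEquiv x).symm)
    have s5 := concat_assoc (fun (r : Fin m) i j => (r, FinBlock.label k i j))
    exact s1.trans (s2.trans ((s3 _).symm.trans ((s4 _).trans (s5 _))))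
  · exact concat_swapEquiv (fun x r => (r, concat (FinBlock.label k) x)) x

end Natural

/-- Naturality with respect to a presented operad can be checked on the generators. -/
theorem isNaturalAt_presented {X : Type u} {Gen : ∀ ⦃n : ℕ⦄, (Fin n → X) → X → Type u}
    {rel : ∀ ⦃n : ℕ⦄ ⦃c : Fin n → X⦄ ⦃p : X⦄, Term Gen c p → Term Gen c p → Prop}
    {T : SymmOperad.{u}} {m : ℕ} {A : Fin m → (presented rel ⟶ T)} {A₀ : presented rel ⟶ T}
    {β : ∀ x : X, T.Hom (fun j => Functor.obj (A j) x) (Functor.obj A₀ x)}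
    (h : ∀ {n : ℕ} {c : Fin n → X} {p : X} (a : Gen c p), IsNaturalAt A A₀ β (ofGen rel a))
    {n : ℕ} {c : Fin n → X} {p : X} (ψ : (presented rel).Hom c p) : IsNaturalAt A A₀ β ψ := by
  obtain ⟨t, rfl⟩ := Quotient.exists_rep ψ
  induction t with
  | gen a => exact h a
  | id p => exact isNaturalAt_id (S := presented rel) p
  | comp t s iht ihs =>
    have := IsNaturalAt.comp iht ihs
    rwa [presented_comp_mk] at this
  | act σ hσ t ih => exact ih.act σ hσ

end SymmOperad

namespace SymmOperad

/-! ### Functors out of a Boardman–Vogt tensor product -/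

variable {P P' Q Q' R R' : SymmOperad.{u}}

/-- The functor `ψ ↦ ψ ⊗ q`. -/
def leftFun (P : SymmOperad.{u}) {Q : SymmOperad.{u}} (q : Q.Ob) : P ⟶ bv P Q :=
  { obj := fun p => (p, q)
    map := fun ψ => ofGen (BVRel P Q) (BVGen.left ψ q)
    map_id := fun p => Quotient.sound (Rel.of (BVRel.left_id p q))
    map_comp := fun ψ χ =>
      ((presented_comp_mk (rel := BVRel P Q) (leftTerm ψ q) (fun i => leftTerm (χ i) q)).trans
        (Quotient.sound (Rel.of (BVRel.left_comp ψ χ q)))).symm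
    map_act := fun σ h ψ => (Quotient.sound (Rel.of (BVRel.left_act σ h ψ q))).symm }

/-- The functor `φ ↦ p ⊗ φ`. -/
def rightFun {P : SymmOperad.{u}} (p : P.Ob) (Q : SymmOperad.{u}) : Q ⟶ bv P Q :=
  { obj := fun q => (p, q)
    map := fun φ => ofGen (BVRel P Q) (BVGen.right p φ)
    map_id := fun q => Quotient.sound (Rel.of (BVRel.right_id p q))
    map_comp := fun φ χ =>
      ((presented_comp_mk (rel := BVRel P Q) (rightTerm p φ) (fun i => rightTerm p (χ i))).trans
        (Quotient.sound (Rel.of (BVRel.right_comp p φ χ)))).symm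
    map_act := fun σ h φ => (Quotient.sound (Rel.of (BVRel.right_act σ h p φ))).symm }

theorem bv_interchange {n m : ℕ} {c : Fin n → P.Ob} {p : P.Ob} {d : Fin m → Q.Ob} {q : Q.Ob}
    (ψ : P.Hom c p) (φ : Q.Hom d q) :
    (bv P Q).comp (Functor.map (leftFun P q) ψ) (fun i => Functor.map (rightFun (c i) Q) φ) =
      (bv P Q).act (swapEquiv n m) (concat_swapEquiv fun i j => (c i, d j))
        ((bv P Q).comp (Functor.map (rightFun p Q) φ)
          (fun j => Functor.map (leftFun P (d j)) ψ)) :=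
  (presented_comp_mk (rel := BVRel P Q) (leftTerm ψ q) (fun i => rightTerm (c i) φ)).trans
    ((Quotient.sound (Rel.of (BVRel.interchange ψ φ))).trans
      (congrArg ((bv P Q).act (swapEquiv n m) _) (presented_comp_mk (rel := BVRel P Q)
        (rightTerm p φ) (fun j => leftTerm ψ (d j))).symm))

/-- Functors out of a tensor product are determined by their restrictions in each variable. -/
theorem bv_hom_ext {F G : bv P Q ⟶ R} (hl : ∀ q, leftFun P q ≫ F = leftFun P q ≫ G)
    (hr : ∀ p, rightFun p Q ≫ F = rightFun p Q ≫ G) : F = G := by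
  refine presented_hom_ext ?_ ?_
  · rintro ⟨p, q⟩
    exact obj_of_eq (hl q) p
  · rintro n c p (⟨ψ, q⟩ | ⟨p, φ⟩)
    · exact heq_map_of_eq (hl q) ψ
    · exact heq_map_of_eq (hr p) φ

/-- The data of a functor out of the tensor product of `P` and `Q`: a functor in each variable, such
that the values of morphisms in the two variables commute. -/
structure Bifunctor (P Q R : SymmOperad.{u}) where
  /-- the function on objects -/
  obj : P.Ob → Q.Ob → R.Ob
  /-- the morphisms in the first variable -/
  left : ∀ (q : Q.Ob) {n : ℕ} {c : Fin n → P.Ob} {p : P.Ob}, P.Hom c p →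
    R.Hom (fun i => obj (c i) q) (obj p q)
  /-- the morphisms in the second variable -/
  right : ∀ (p : P.Ob) {n : ℕ} {c : Fin n → Q.Ob} {q : Q.Ob}, Q.Hom c q →
    R.Hom (fun i => obj p (c i)) (obj p q)
  left_id : ∀ q p, left q (P.id p) = R.id (obj p q)
  left_comp : ∀ (q : Q.Ob) {n : ℕ} {k : Fin n → ℕ} {c : Fin n → P.Ob}
    {d : ∀ i, Fin (k i) → P.Ob} {p : P.Ob} (ψ : P.Hom c p) (χ : ∀ i, P.Hom (d i) (c i)),
    left q (P.comp ψ χ) = R.comp (left q ψ) (fun i => left q (χ i))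
  left_act : ∀ (q : Q.Ob) {n m : ℕ} {c : Fin m → P.Ob} {d : Fin n → P.Ob} {p : P.Ob}
    (σ : Fin n ≃ Fin m) (h : ∀ i, d i = c (σ i)) (ψ : P.Hom c p),
    left q (P.act σ h ψ) = R.act σ (fun i => congrArg (fun a => obj a q) (h i)) (left q ψ)
  right_id : ∀ p q, right p (Q.id q) = R.id (obj p q)
  right_comp : ∀ (p : P.Ob) {n : ℕ} {k : Fin n → ℕ} {c : Fin n → Q.Ob}
    {d : ∀ i, Fin (k i) → Q.Ob} {q : Q.Ob} (φ : Q.Hom c q) (χ : ∀ i, Q.Hom (d i) (c i)),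
    right p (Q.comp φ χ) = R.comp (right p φ) (fun i => right p (χ i))
  right_act : ∀ (p : P.Ob) {n m : ℕ} {c : Fin m → Q.Ob} {d : Fin n → Q.Ob} {q : Q.Ob}
    (σ : Fin n ≃ Fin m) (h : ∀ i, d i = c (σ i)) (φ : Q.Hom c q),
    right p (Q.act σ h φ) = R.act σ (fun i => congrArg (fun b => obj p b) (h i)) (right p φ)
  interchange : ∀ {n m : ℕ} {c : Fin n → P.Ob} {p : P.Ob} {d : Fin m → Q.Ob} {q : Q.Ob}
    (ψ : P.Hom c p) (φ : Q.Hom d q),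
    R.comp (left q ψ) (fun i => right (c i) φ) =
      R.act (swapEquiv n m) (concat_swapEquiv fun i j => obj (c i) (d j))
        (R.comp (right p φ) (fun j => left (d j) ψ))

/-- The values of the generators under the functor given by a bifunctor. -/
def Bifunctor.gen (B : Bifunctor P Q R) :
    ∀ ⦃n : ℕ⦄ ⦃c : Fin n → P.Ob × Q.Ob⦄ ⦃x : P.Ob × Q.Ob⦄, BVGen P Q c x →
      R.Hom (fun i => B.obj (c i).1 (c i).2) (B.obj x.1 x.2)
  | _, _, _, .left ψ q => B.left q ψ
  | _, _, _, .right p φ => B.right p φ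

/-- The universal property of the tensor product. -/
noncomputable def Bifunctor.lift (B : Bifunctor P Q R) : bv P Q ⟶ R :=
  presentedLift (BVRel P Q) (fun x => B.obj x.1 x.2) B.gen (by
    intro n c x t t' h
    cases h with
    | left_id p q => exact B.left_id q p
    | left_comp ψ χ q => exact (B.left_comp q ψ χ).symm
    | left_act σ h ψ q => exact (B.left_act q σ h ψ).symm
    | right_id p q => exact B.right_id p q
    | right_comp p φ χ => exact (B.right_comp p φ χ).symm
    | right_act σ h p φ => exact (B.right_act p σ h φ).symm
    | interchange ψ φ => exact B.interchange ψ φ)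

theorem bvMap_id (P Q : SymmOperad.{u}) : bvMap (𝟙 P) (𝟙 Q) = 𝟙 (bv P Q) :=
  bv_hom_ext (fun _ => rfl) (fun _ => rfl)

theorem bvMap_comp {P'' Q'' : SymmOperad.{u}} (F : P ⟶ P') (F' : P' ⟶ P'') (G : Q ⟶ Q')
    (G' : Q' ⟶ Q'') : bvMap (F ≫ F') (G ≫ G') = bvMap F G ≫ bvMap F' G' :=
  bv_hom_ext (fun _ => rfl) (fun _ => rfl)

/-! ### The symmetry, the associativity and the unit isomorphisms -/

/-- The symmetry of the tensor product. -/
noncomputable def braid (P Q : SymmOperad.{u}) : bv P Q ⟶ bv Q P :=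
  Bifunctor.lift
    { obj := fun p q => (q, p)
      left := fun q _ _ _ ψ => Functor.map (rightFun q P) ψ
      right := fun p _ _ _ φ => Functor.map (leftFun Q p) φ
      left_id := fun q p => Functor.map_id (rightFun q P) p
      left_comp := fun q _ _ _ _ _ ψ χ => Functor.map_comp (rightFun q P) ψ χ
      left_act := fun q _ _ _ _ _ σ h ψ => Functor.map_act (rightFun q P) σ h ψ
      right_id := fun p q => Functor.map_id (leftFun Q p) q
      right_comp := fun p _ _ _ _ _ φ χ => Functor.map_comp (leftFun Q p) φ χ
      right_act := fun p _ _ _ _ _ σ h φ => Functor.map_act (leftFun Q p) σ h φ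
      interchange := fun {n m c _ d _} ψ φ =>
        (((bv Q P).act_symm_act (swapEquiv m n) (concat_swapEquiv fun j i => (d j, c i))
          (concat_swapEquiv fun i j => (d j, c i)) _).symm.trans
            (congrArg ((bv Q P).act (swapEquiv n m) _) (bv_interchange φ ψ).symm)) }

theorem braid_braid (P Q : SymmOperad.{u}) : braid P Q ≫ braid Q P = 𝟙 (bv P Q) :=
  bv_hom_ext (fun _ => rfl) (fun _ => rfl)

/-- Morphisms of `P ⊗ Q` commute with those of `R` in `P ⊗ (Q ⊗ R)`. -/
theorem assoc_isNaturalAt {n m : ℕ} {c : Fin n → (bv P Q).Ob} {x : (bv P Q).Ob}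
    (ψ : (bv P Q).Hom c x) {d : Fin m → R.Ob} {s : R.Ob} (φ : R.Hom d s) :
    IsNaturalAt (fun j => bvMap (𝟙 P) (leftFun Q (d j))) (bvMap (𝟙 P) (leftFun Q s))
      (fun y => Functor.map (rightFun y.1 (bv Q R)) (Functor.map (rightFun y.2 R) φ)) ψ := by
  refine isNaturalAt_presented (rel := BVRel P Q) ?_ ψ
  rintro n c x (⟨ψ, q⟩ | ⟨p, χ⟩)
  · exact bv_interchange ψ (Functor.map (rightFun q R) φ)
  · rename_i c' q
    have h := congrArg (Functor.map (rightFun p (bv Q R))) (bv_interchange χ φ)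
    exact ((Functor.map_comp (rightFun p (bv Q R)) (Functor.map (leftFun Q s) χ)
      (fun i => Functor.map (rightFun (c' i) R) φ)).symm.trans h).trans
      ((Functor.map_act _ _ _ _).trans (congrArg ((bv P (bv Q R)).act _ _)
        (Functor.map_comp (rightFun p (bv Q R)) _ _)))

/-- The associativity functor. -/
noncomputable def assocHom (P Q R : SymmOperad.{u}) : bv (bv P Q) R ⟶ bv P (bv Q R) :=
  Bifunctor.lift
    { obj := fun x s => (x.1, (x.2, s))
      left := fun s _ _ _ ψ => Functor.map (bvMap (𝟙 P) (leftFun Q s)) ψ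
      right := fun x _ _ _ φ => Functor.map (rightFun x.2 R ≫ rightFun x.1 (bv Q R)) φ
      left_id := fun s x => Functor.map_id (bvMap (𝟙 P) (leftFun Q s)) x
      left_comp := fun s _ _ _ _ _ ψ χ => Functor.map_comp (bvMap (𝟙 P) (leftFun Q s)) ψ χ
      left_act := fun s _ _ _ _ _ σ h ψ => Functor.map_act (bvMap (𝟙 P) (leftFun Q s)) σ h ψ
      right_id := fun x s => Functor.map_id (rightFun x.2 R ≫ rightFun x.1 (bv Q R)) s
      right_comp := fun x _ _ _ _ _ φ χ =>
        Functor.map_comp (rightFun x.2 R ≫ rightFun x.1 (bv Q R)) φ χ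
      right_act := fun x _ _ _ _ _ σ h φ =>
        Functor.map_act (rightFun x.2 R ≫ rightFun x.1 (bv Q R)) σ h φ
      interchange := fun ψ φ => assoc_isNaturalAt ψ φ }

/-- The inverse of the associativity functor, obtained from it by means of the symmetry. -/
noncomputable def assocInv (P Q R : SymmOperad.{u}) : bv P (bv Q R) ⟶ bv (bv P Q) R :=
  braid P (bv Q R) ≫ bvMap (braid Q R) (𝟙 P) ≫ assocHom R Q P ≫ bvMap (𝟙 R) (braid Q P) ≫
    braid R (bv P Q)

/-- The associativity isomorphism. -/
noncomputable def bvAssoc (P Q R : SymmOperad.{u}) : bv (bv P Q) R ≅ bv P (bv Q R) where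
  hom := assocHom P Q R
  inv := assocInv P Q R
  hom_inv_id := bv_hom_ext (fun _ => bv_hom_ext (fun _ => rfl) (fun _ => rfl)) (fun _ => rfl)
  inv_hom_id := bv_hom_ext (fun _ => rfl) (fun _ => bv_hom_ext (fun _ => rfl) (fun _ => rfl))

/-- The value at `p` of a morphism of the unit operad: the identity of `p`, whose domain is regarded
as a list of length `n = 1`. -/
def starVal (P : SymmOperad.{u}) (p : P.Ob) {n : ℕ} (h : n = 1) : P.Hom (fun _ : Fin n => p) p :=
  P.act (finCongr h) (fun _ => rfl) (P.id p)

theorem act_unary_id (P : SymmOperad.{u}) (p : P.Ob) {n : ℕ} (h : n = 1) (σ : Fin n ≃ Fin 1) :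
    P.act σ (fun _ => rfl) (P.id p) = starVal P p h :=
  P.act_congr (Subsingleton.elim _ _) _ _ _

theorem starVal_one (P : SymmOperad.{u}) (p : P.Ob) (h : 1 = 1) : starVal P p h = P.id p :=
  P.act_self _ (Subsingleton.elim _ _) _ _

/-- The left unit functor. -/
noncomputable def leftUnitHom (P : SymmOperad.{u}) : bv star P ⟶ P :=
  Bifunctor.lift
    { obj := fun _ p => p
      left := fun p _ _ _ ψ => starVal P p ψ.down.down
      right := fun _ _ _ _ φ => φ
      left_id := fun q p => starVal_one P q _
      left_comp := fun q {n k c d p} ψ χ => by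
        obtain ⟨⟨h⟩⟩ := ψ
        subst h
        obtain rfl : k = fun _ => 1 := funext fun i => (χ i).down.down
        simp only [starVal_one]
        exact ((P.id_comp (P.id q)).trans (act_unary_id P q _ _)).symm
      left_act := fun q {n m c d p} σ h ψ => by
        obtain ⟨⟨h⟩⟩ := ψ
        subst h
        rw [starVal_one]
        exact (act_unary_id P q _ σ).symm
      right_id := fun _ _ => rfl
      right_comp := fun _ _ _ _ _ _ _ _ => rfl
      right_act := fun _ _ _ _ _ _ _ _ _ => rfl
      interchange := fun {n m c p d q} ψ φ => by
        obtain ⟨⟨h⟩⟩ := ψ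
        subst h
        simp only [starVal_one]
        refine (P.id_comp φ).trans (Eq.trans ?_
          ((congrArg (P.act _ _) (P.comp_id φ)).trans (P.act_act _ _ _ _ _)).symm)
        exact P.act_congr (equiv_eq_of_label (c := fun j => j) (fun _ _ h => h)
          (concat_oneBlockEquiv _) (concat_swapEquiv fun (_ : Fin 1) j => j)) _ _ _ }

theorem star_hom_ext {F G : star ⟶ P} (h : Functor.obj F PUnit.unit = Functor.obj G PUnit.unit) :
    F = G := by
  refine functor_ext (fun _ => h) fun {n c p} ψ => ?_
  obtain ⟨⟨hn⟩⟩ := ψ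
  subst hn
  have hF : Functor.map F (star.id PUnit.unit) = P.id (Functor.obj F PUnit.unit) :=
    Functor.map_id F _
  have hG : Functor.map G (star.id PUnit.unit) = P.id (Functor.obj G PUnit.unit) :=
    Functor.map_id G _
  exact (heq_of_eq hF).trans (HEq.trans (by rw [h]) (heq_of_eq hG).symm)

/-- The left unit isomorphism. -/
noncomputable def bvLeftUnitor (P : SymmOperad.{u}) : bv star P ≅ P where
  hom := leftUnitHom P
  inv := rightFun (P := star) PUnit.unit P
  hom_inv_id := bv_hom_ext (fun _ => star_hom_ext rfl) (fun _ => rfl)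
  inv_hom_id := rfl

/-- The right unit isomorphism. -/
noncomputable def bvRightUnitor (P : SymmOperad.{u}) : bv P star ≅ P where
  hom := braid P star ≫ leftUnitHom P
  inv := leftFun P (Q := star) PUnit.unit
  hom_inv_id := bv_hom_ext (fun _ => rfl) (fun _ => star_hom_ext rfl)
  inv_hom_id := rfl

/-- The Boardman–Vogt monoidal structure. -/
@[reducible]
noncomputable def bvMonoidal : MonoidalCategory SymmOperad.{u} :=
  { bvMonoidalStruct bvAssoc bvLeftUnitor bvRightUnitor with
    tensorHom_def := fun _ _ => bv_hom_ext (fun _ => rfl) (fun _ => rfl)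
    id_tensorHom_id := bvMap_id
    tensorHom_comp_tensorHom := fun _ _ _ _ => (bvMap_comp _ _ _ _).symm
    whiskerLeft_id := bvMap_id
    id_whiskerRight := bvMap_id
    associator_naturality := fun _ _ _ =>
      bv_hom_ext (fun _ => bv_hom_ext (fun _ => rfl) (fun _ => rfl)) (fun _ => rfl)
    leftUnitor_naturality := fun _ => bv_hom_ext (fun _ => star_hom_ext rfl) (fun _ => rfl)
    rightUnitor_naturality := fun _ => bv_hom_ext (fun _ => rfl) (fun _ => star_hom_ext rfl)
    pentagon := fun _ _ _ _ => bv_hom_ext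
      (fun _ => bv_hom_ext (fun _ => bv_hom_ext (fun _ => rfl) (fun _ => rfl)) (fun _ => rfl))
      (fun _ => rfl)
    triangle := fun _ _ => bv_hom_ext (fun _ => bv_hom_ext (fun _ => rfl)
      (fun _ => star_hom_ext rfl)) (fun _ => rfl) }

end SymmOperad

namespace SymmOperad

/-! ### Tensor products of trivial cofibrations -/

variable {P P' Q Q' : SymmOperad.{u}}

/-- The interchange law with a unary morphism in the first variable: it is natural with respect to
`Q`. -/
theorem post_leftFun {a b : P.Ob} (ψ : P.Hom (fun _ : Fin 1 => a) b) {m : ℕ} {d : Fin m → Q.Ob}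
    {q : Q.Ob} (φ : Q.Hom d q) :
    (bv P Q).post (Functor.map (rightFun a Q) φ) (Functor.map (leftFun P q) ψ) =
      (bv P Q).pre (c := fun j => (b, d j)) (fun j => Functor.map (leftFun P (d j)) ψ)
        (Functor.map (rightFun b Q) φ) := by
  have h := (comp_eq_post _ _ _).symm.trans ((bv_interchange ψ φ).trans ((congrArg
    ((bv P Q).act (swapEquiv 1 m) _) (comp_eq_pre (bv P Q) (c := fun j => (b, d j))
      (d := fun j => (a, d j)) (fun j => Functor.map (leftFun P (d j)) ψ)
      (Functor.map (rightFun b Q) φ))).trans ((bv P Q).act_act _ _ _ _ _)))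
  refine (bv P Q).eq_of_act_eq ?_ h
  exact equiv_eq_of_label (c := fun j => j) (fun _ _ h => h) (concat_oneBlockEquiv _)
    (concat_swapEquiv fun (_ : Fin 1) j => j)

/-- The tensor product respects isomorphisms of functors in the first variable. -/
theorem bvMap_conj (F : P ⟶ P') (l : P.Ob → P'.Ob) (θ : ∀ p, ObIso P' (Functor.obj F p) (l p))
    (G : Q ⟶ Q') :
    bvMap (conj F l θ) G = conj (bvMap F G) (fun x => (l x.1, Functor.obj G x.2))
      (fun x => mapObIso (leftFun P' (Functor.obj G x.2)) (θ x.1)) := by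
  refine bv_hom_ext (fun q => conj_comp F l θ (leftFun P' (Functor.obj G q))) fun p => ?_
  refine functor_ext (fun _ => rfl) fun {m d q} φ => heq_of_eq ?_
  refine Eq.symm ((congrArg ((bv P' Q').pre _) (post_leftFun (θ p).hom (Functor.map G φ))).trans
    (((bv P' Q').pre_pre _ _ _).trans (Eq.trans ?_ ((bv P' Q').pre_id _))))
  exact congrArg (fun g => (bv P' Q').pre g _) (funext fun j =>
    post_inv_hom (mapObIso (leftFun P' (Functor.obj G (d j))) (θ p)))

/-- The inclusion of a strong deformation retract is an operadic equivalence. -/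
theorem operadicEquivalences_of_retraction {H : P ⟶ Q} {S : Q ⟶ P} (h : H ≫ S = 𝟙 P)
    (θ : ∀ q, ObIso Q (Functor.obj H (Functor.obj S q)) q)
    (hθ : conj (S ≫ H) (fun q => q) θ = 𝟙 Q) : operadicEquivalences H := by
  have hSH : IsFullyFaithful (S ≫ H) := by
    have := isFullyFaithful_conj (F := conj (S ≫ H) (fun q => q) θ) (hθ ▸ isFullyFaithful_id Q)
      (Functor.obj (S ≫ H)) (fun q => (θ q).symm)
    rwa [conj_conj_symm] at this
  have hHS : IsFullyFaithful (H ≫ S) := h ▸ isFullyFaithful_id P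
  refine operadicEquivalences_iff.2 ⟨fun q => ⟨_, ⟨θ q⟩⟩, fun n c p =>
    ⟨Function.Injective.of_comp (hHS n c p).1, fun φ => ?_⟩⟩
  obtain ⟨χ, hχ⟩ := exists_heq (fun i => obj_of_eq h (c i)) (obj_of_eq h p) (Functor.map S φ)
  have hS : Function.Injective fun ψ : Q.Hom (fun i => Functor.obj H (c i)) (Functor.obj H p) =>
      Functor.map S ψ := Function.Injective.of_comp (hSH n _ _).1
  exact ⟨χ, hS (eq_of_heq ((heq_map_of_eq_id h χ).trans hχ))⟩

theorem operadicEquivalences_of_inverse {H : P ⟶ Q} {S : Q ⟶ P} (h : H ≫ S = 𝟙 P)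
    (h' : S ≫ H = 𝟙 Q) : operadicEquivalences H :=
  operadicEquivalences_of_retraction h (fun q => eqObIso (obj_of_eq h' q))
    ((conj_eqToIso _ _ _ fun q => ⟨congrArg Underlying.mk (obj_of_eq h' q), rfl⟩).trans h')

theorem injectiveOnObjects_bvMap {F : P ⟶ P'} {G : Q ⟶ Q'} (hF : injectiveOnObjects F)
    (hG : injectiveOnObjects G) : injectiveOnObjects (bvMap F G) := fun _ _ h =>
  Prod.ext (hF (congrArg Prod.fst h)) (hG (congrArg Prod.snd h))

theorem operadicEquivalences_bvMap_left {F : P ⟶ P'} (hF : injectiveOnObjects F)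
    (hF' : operadicEquivalences F) (Q : SymmOperad.{u}) :
    operadicEquivalences (bvMap F (𝟙 Q)) := by
  obtain ⟨R, θ, hR, hθ, -⟩ := exists_retraction hF hF'
  have h1 : bvMap F (𝟙 Q) ≫ bvMap R (𝟙 Q) = 𝟙 _ := by
    rw [← bvMap_comp, hR, Category.id_comp, bvMap_id]
  have h2 : bvMap R (𝟙 Q) ≫ bvMap F (𝟙 Q) = bvMap (R ≫ F) (𝟙 Q) := by
    rw [← bvMap_comp, Category.id_comp]
  refine operadicEquivalences_of_retraction h1
    (fun x => mapObIso (leftFun P' x.2) (θ x.1)) ?_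
  refine (conj_congr h2 (fun _ => rfl) _ (fun x => mapObIso (leftFun P' x.2) (θ x.1))
    fun _ => ((Iso.refl_trans _).trans (Iso.trans_refl _)).symm).trans ?_
  exact (bvMap_conj (R ≫ F) (fun p => p) θ (𝟙 Q)).symm.trans (by rw [hθ, bvMap_id])

theorem operadicEquivalences_bvMap_right {F : P ⟶ P'} (hF : injectiveOnObjects F)
    (hF' : operadicEquivalences F) (Q : SymmOperad.{u}) :
    operadicEquivalences (bvMap (𝟙 Q) F) := by
  have := hasTwoOutOfThreeProperty_operadicEquivalences.{u}
  have h : bvMap (𝟙 Q) F = braid Q P ≫ bvMap F (𝟙 Q) ≫ braid P' Q :=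
    bv_hom_ext (fun _ => rfl) (fun _ => rfl)
  have hb : ∀ P Q : SymmOperad.{u}, operadicEquivalences (braid P Q) := fun P Q =>
    operadicEquivalences_of_inverse (braid_braid P Q) (braid_braid Q P)
  rw [h]
  exact operadicEquivalences.comp_mem _ _ (hb _ _)
    (operadicEquivalences.comp_mem _ _ (operadicEquivalences_bvMap_left hF hF' Q) (hb _ _))

/-! ### The pushout-product axiom -/

theorem toChaotic_ext {S : Type u} {F G : P ⟶ chaotic S}
    (h : ∀ p, Functor.obj F p = Functor.obj G p) : F = G :=
  functor_ext h fun _ => HEq.rfl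

/-- The two functors into a pushout are jointly surjective on objects. -/
theorem exists_of_isPushout {A B C K : SymmOperad.{u}} {f : A ⟶ B} {g : A ⟶ C} {a : B ⟶ K}
    {b : C ⟶ K} (h : IsPushout f g a b) (k : K.Ob) :
    (∃ x, Functor.obj a x = k) ∨ ∃ y, Functor.obj b y = k := by
  -- The indicator function of the joint image and the constant function agree on `B` and on `C`.
  have := h.hom_ext (toChaotic_ext (F := a ≫ toChaotic K (S := ULift.{u} Prop) fun k =>
      ⟨(∃ x, Functor.obj a x = k) ∨ ∃ y, Functor.obj b y = k⟩)
    (G := a ≫ toChaotic K fun _ => ⟨True⟩) fun x =>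
      congrArg ULift.up (eq_true (Or.inl ⟨x, rfl⟩)))
    (toChaotic_ext fun y => congrArg ULift.up (eq_true (Or.inr ⟨y, rfl⟩)))
  exact of_eq_true (congrArg ULift.down (obj_of_eq this k))

theorem injectiveOnObjects_pushoutProduct {A B A' B' K : SymmOperad.{u}} {F : A ⟶ B} {G : A' ⟶ B'}
    {a : bv B A' ⟶ K} {b : bv A B' ⟶ K} {w : K ⟶ bv B B'}
    (h : IsPushout (bvMap F (𝟙 A')) (bvMap (𝟙 A) G) a b)
    (ha : a ≫ w = bvMap (𝟙 B) G) (hb : b ≫ w = bvMap F (𝟙 B')) (hF : injectiveOnObjects F)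
    (hG : injectiveOnObjects G) : injectiveOnObjects w := by
  have hia : Function.Injective (Functor.obj (a ≫ w)) := by
    rw [ha]
    exact injectiveOnObjects_bvMap (fun _ _ h => h) hG
  have hib : Function.Injective (Functor.obj (b ≫ w)) := by
    rw [hb]
    exact injectiveOnObjects_bvMap hF (fun _ _ h => h)
  have hab : ∀ x y, Functor.obj w (Functor.obj a x) = Functor.obj w (Functor.obj b y) →
      Functor.obj a x = Functor.obj b y := by
    rintro ⟨p, q⟩ ⟨p', q'⟩ hxy
    have hxy' := (obj_of_eq ha (p, q)).symm.trans (hxy.trans (obj_of_eq hb (p', q')))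
    obtain rfl : p = Functor.obj F p' := congrArg Prod.fst hxy'
    obtain rfl : Functor.obj G q = q' := congrArg Prod.snd hxy'
    exact obj_of_eq h.w (p', q)
  intro k k' hk
  obtain ⟨x, rfl⟩ | ⟨x, rfl⟩ := exists_of_isPushout h k <;>
    obtain ⟨y, rfl⟩ | ⟨y, rfl⟩ := exists_of_isPushout h k'
  · exact congrArg _ (hia hk)
  · exact hab _ _ hk
  · exact (hab _ _ hk.symm).symm
  · exact congrArg _ (hib hk)

theorem operadicEquivalences_pushoutProduct {A B A' B' K : SymmOperad.{u}} {F : A ⟶ B}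
    {G : A' ⟶ B'} {a : bv B A' ⟶ K} {b : bv A B' ⟶ K} {w : K ⟶ bv B B'}
    (h : IsPushout (bvMap F (𝟙 A')) (bvMap (𝟙 A) G) a b)
    (ha : a ≫ w = bvMap (𝟙 B) G) (hb : b ≫ w = bvMap F (𝟙 B')) (hF : injectiveOnObjects F)
    (hG : injectiveOnObjects G) (hFG : operadicEquivalences F ∨ operadicEquivalences G) :
    operadicEquivalences w := by
  have := hasTwoOutOfThreeProperty_operadicEquivalences.{u}
  let := modelCategory.{u}
  obtain hF' | hG' := hFG
  · have h1 : trivialCofibrations _ (bvMap F (𝟙 A')) :=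
      ⟨injectiveOnObjects_bvMap hF fun _ _ h => h, operadicEquivalences_bvMap_left hF hF' A'⟩
    have h2 : trivialCofibrations _ b := MorphismProperty.of_isPushout h.flip h1
    refine operadicEquivalences.of_precomp (W' := operadicEquivalences) b w h2.2 ?_
    rw [hb]
    exact operadicEquivalences_bvMap_left hF hF' B'
  · have h1 : trivialCofibrations _ (bvMap (𝟙 A) G) :=
      ⟨injectiveOnObjects_bvMap (fun _ _ h => h) hG, operadicEquivalences_bvMap_right hG hG' A⟩
    have h2 : trivialCofibrations _ a := MorphismProperty.of_isPushout h h1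
    refine operadicEquivalences.of_precomp (W' := operadicEquivalences) a w h2.2 ?_
    rw [ha]
    exact operadicEquivalences_bvMap_right hG hG' B

/-- The initial operad has no objects, because it maps to the chaotic operad without objects. -/
theorem injectiveOnObjects_of_initial (X : SymmOperad.{u}) :
    injectiveOnObjects (initial.to X) := fun x =>
  PEmpty.elim (Functor.obj (initial.to (chaotic PEmpty.{u + 1})) x)

end SymmOperad

theorem mainTheorem2 :
    ∃ (α : ∀ P Q R : SymmOperad.{u},
        SymmOperad.bv (SymmOperad.bv P Q) R ≅ SymmOperad.bv P (SymmOperad.bv Q R))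
      (l : ∀ P : SymmOperad.{u}, SymmOperad.bv SymmOperad.star P ≅ P)
      (r : ∀ P : SymmOperad.{u}, SymmOperad.bv P SymmOperad.star ≅ P)
      (mon : MonoidalCategory SymmOperad.{u}) (model : ModelCategory SymmOperad.{u}),
      -- the monoidal structure is the Boardman–Vogt one, with the evident coherence maps
      (∀ (P Q R : SymmOperad.{u}) (p : P.Ob) (q : Q.Ob) (s : R.Ob),
        SymmOperad.Functor.obj (α P Q R).hom ((p, q), s) = (p, (q, s))) ∧
      (∀ (P : SymmOperad.{u}) (p : P.Ob),
        SymmOperad.Functor.obj (l P).hom (PUnit.unit, p) = p) ∧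
      (∀ (P : SymmOperad.{u}) (p : P.Ob),
        SymmOperad.Functor.obj (r P).hom (p, PUnit.unit) = p) ∧
      mon.toMonoidalCategoryStruct = SymmOperad.bvMonoidalStruct α l r ∧
      -- the three classes of the model structure
      weakEquivalences SymmOperad.{u} = SymmOperad.operadicEquivalences ∧
      cofibrations SymmOperad.{u} = SymmOperad.injectiveOnObjects ∧
      fibrations SymmOperad.{u} = SymmOperad.isofibrations ∧
      IsMonoidalModelCategory SymmOperad.{u} := by
  refine ⟨SymmOperad.bvAssoc, SymmOperad.bvLeftUnitor, SymmOperad.bvRightUnitor,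
    SymmOperad.bvMonoidal, SymmOperad.modelCategory, fun _ _ _ _ _ _ => rfl, fun _ _ => rfl,
    fun _ _ => rfl, rfl, rfl, rfl, rfl, ?_⟩
  let := SymmOperad.bvMonoidal.{u}
  let := SymmOperad.modelCategory.{u}
  exact
    { hasLimits := inferInstance
      hasColimits := inferInstance
      isCofibrant := fun X => ⟨SymmOperad.injectiveOnObjects_of_initial X⟩
      cofibration := fun F G a b w h ha hb hF hG =>
        SymmOperad.injectiveOnObjects_pushoutProduct h ha hb hF hG
      trivialCofibration := fun F G a b w h ha hb hF hG hFG =>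
        ⟨SymmOperad.injectiveOnObjects_pushoutProduct h ha hb hF hG,
          SymmOperad.operadicEquivalences_pushoutProduct h ha hb hF hG hFG⟩ }
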